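/- **Setting.** Consider the graph with one vertex $v$ and one loop $\alpha$ based at $v$; its smooth cylindrical functions are the smooth functions $f$ of the holonomy $g=h_\alpha\in SU(2)$. Let $\tau_1,\tau_2,\tau_3$ be any basis of $su(2)$ with $[\tau_i,\tau_j]=\epsilon_{ijk}\tau_k$. The beginning and the ending segment of the loop give the operators $$(J^i_{\alpha_b}f)(g)=i\tfrac{d}{dt}\Big|_{t=0}f(g\,e^{t\tau_i}),\qquad (J^i_{\alpha_e}f)(g)=i\tfrac{d}{dt}\Big|_{t=0}f(e^{-t\tau_i}g).$$ Let $D^j$ be the Wigner matrix of spin $j\in\tfrac12\mathbb N$ and $D'^{(l)}$ the differential of $D^l$. The Euclidean operator, for $l=\tfrac12$, is $${}^{\rm kin}\hat H^E=\epsilon_{ijk}J^j_{\alpha_e}J^k_{\alpha_b}(h^i_\alpha)^{(l)},\qquad (h^i_\alpha)^{(l)}=-\frac{3}{l(l+1)(2l+1)}\mathrm{Tr}\big(D^{(l)}(h_\alpha)D'^{(l)}(\tau_i)\big),$$ where $(h^i_\alpha)^{(l)}$ acts by multiplication. For a constant $\mathfrak A\neq0$ the Lorentzian operator is $${}^{\rm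 kin}\hat H^L=\sqrt{\delta^{ii'}(\epsilon_{ijk}J^j_{\alpha_b}J^k_{\alpha_b})(\epsilon_{i'j'k'}J^{j'}_{\alpha_e}J^{k'}_{\alpha_e})}\left(\frac{2\pi}{\mathfrak A}-\pi+\arccos\left[\frac{J_{\alpha_b}\cdot J_{\alpha_e}}{\sqrt{J_{\alpha_b}^2}\sqrt{J_{\alpha_e}^2}}\right]\right),$$ a function of operators understood through their joint eigenvectors, on the span of those joint eigenvectors for which the square roots are real (the quotient being read as $0$ where its denominator vanishes). The states are $|j\rangle$, the function $g\mapsto\mathrm{Tr}\,D^j(g)$, and, for integers $0\le k\le 2j$ and $-k\le m\le k$, $$\|j,k\rangle_m:\ g\mapsto\sum_{\mu,\nu}(-1)^{j-\mu}\begin{pmatrix}j&k&j\\-\mu&m&\nu\end{pmatrix}D^j_{\nu\mu}(g),\qquad |j,k\rangle_m=\sqrt{2j+1}\,\|j,k\rangle_m ,$$ i.e. the loop of spin $j$ closed by a trivalent vertex (a Wigner 3j-symbol) with a free leg of spin $k$. States with $k>2j$ or negative spin, which below occur only with coefficient $0$, are read as $0$. The index $m$ is suppressed in what follows. **Claim.**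 1. For every spin $j\neq0$, $${}^{\rm kin}\hat H^E|j\rangle=(j+\tfrac32)\,|j+\tfrac12\rangle-(j-\tfrac12)\,|j-\tfrac12\rangle .$$ 2. For every spin $j$, $|j\rangle$ lies in the domain of ${}^{\rm kin}\hat H^L$ and $${}^{\rm kin}\hat H^L|j\rangle=\frac{2\pi}{\mathfrak A}\sqrt{j(j+1)}\,|j\rangle ;$$ in particular the eigenvalue is $\sqrt{j(j+1)}$ for $\mathfrak A=2\pi$. 3. $|j,0\rangle=|j\rangle$ for every spin $j$, and, for every spin $j\ne0$, every integer $0\le k\le2j$ and every $-k\le m\le k$, $$\begin{aligned}{}^{\rm kin}\hat H^E\|j,k\rangle={}&\frac{\sqrt{(2j-k+1)(2j+k+2)}\,(2j+3+k(k+1))}{2(2j+1)}\,\|j+\tfrac12,k\rangle\\&-\frac{\sqrt{(2j-k)(2j+k+1)}\,(2j-1-k(k+1))}{2(2j+1)}\,\|j-\tfrac12,k\rangle,\end{aligned}$$ $$\begin{aligned}{}^{\rm kin}\hat H^E|j,k\rangle={}&\frac{\sqrt{(2j-k+1)(2j+k+2)}\,(2j+3+k(k+1))}{2\sqrt{(2j+1)(2j+2)}}\,|j+\tfrac12,k\rangle\\&-\frac{\sqrt{(2j-k)(2j+k+1)}\,(2j-1-k(k+1))}{2\sqrt{2j(2j+1)}}\,|j-\tfrac12,k\rangle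 .\end{aligned}$$ -/

import Mathlib

open scoped ContDiff

noncomputable section

/-- The group `SU(2)`. -/
abbrev SU2 : Type := ↥(Matrix.specialUnitaryGroup (Fin 2) ℂ)

/-- The totally antisymmetric symbol on three indices, with `eps 0 1 2 = 1`. -/
def eps (i j k : Fin 3) : ℂ :=
  ((j.1 : ℂ) - (i.1 : ℂ)) * ((k.1 : ℂ) - (i.1 : ℂ)) * ((k.1 : ℂ) - (j.1 : ℂ)) / 2

/-- A basis `τ₁, τ₂, τ₃` of `su(2)` (three linearly independent traceless anti-Hermitian matrices)
with `[τᵢ, τⱼ] = εᵢⱼₖ τₖ`. -/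
structure SU2Basis where
  τ : Fin 3 → Matrix (Fin 2) (Fin 2) ℂ
  skew : ∀ i, (τ i).conjTranspose = -τ i
  traceless : ∀ i, (τ i).trace = 0
  linearIndependent : LinearIndependent ℝ τ
  bracket : ∀ i j, τ i * τ j - τ j * τ i = ∑ k, eps i j k • τ k

/-! ### One-parameter subgroups of `SU(2)` -/

theorem det_exp_of_traceless (A : Matrix (Fin 2) (Fin 2) ℂ) (hA : A.trace = 0) :
    (NormedSpace.exp A).det = 1 := by
  let U : Matrix (Fin 2) (Fin 2) ℂ := !![0, 1; -1, 0]
  have hUdet : U.det = 1 := by simp [U, Matrix.det_fin_two]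
  have hU : IsUnit U := by
    rw [Matrix.isUnit_iff_isUnit_det, hUdet]; exact isUnit_one
  have hUinv : U⁻¹ = !![0, -1; 1, 0] := by
    rw [Matrix.inv_def, hUdet, Matrix.adjugate_fin_two]; simp [U]
  have key : ∀ M : Matrix (Fin 2) (Fin 2) ℂ, M.adjugate = U * M.transpose * U⁻¹ := by
    intro M
    rw [hUinv, Matrix.adjugate_fin_two]
    ext i j
    fin_cases i <;> fin_cases j <;> simp [U, Matrix.mul_apply, Matrix.vecMul,
      dotProduct, Fin.sum_univ_two]
  have hneg : U * A.transpose * U⁻¹ = -A := by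
    rw [← key, Matrix.adjugate_fin_two]
    rw [Matrix.trace_fin_two] at hA
    have h1 : A 1 1 = -A 0 0 := by linear_combination hA
    ext i j
    fin_cases i <;> fin_cases j <;> simp [h1]
  have hadj : (NormedSpace.exp A).adjugate = NormedSpace.exp (-A) := by
    rw [key, ← Matrix.exp_transpose, ← Matrix.exp_conj _ _ hU, hneg]
  have hprod : NormedSpace.exp A * NormedSpace.exp (-A) = 1 := by
    rw [← Matrix.exp_add_of_commute A (-A) (Commute.neg_right (Commute.refl A))]
    simp
  have h := Matrix.mul_adjugate (NormedSpace.exp A)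
  rw [hadj, hprod] at h
  have h00 := congrFun (congrFun h 0) 0
  simpa using h00.symm

theorem exp_mem_SU2 (A : Matrix (Fin 2) (Fin 2) ℂ) (hA : A.conjTranspose = -A)
    (ht : A.trace = 0) : NormedSpace.exp A ∈ Matrix.specialUnitaryGroup (Fin 2) ℂ := by
  rw [Matrix.mem_specialUnitaryGroup_iff]
  refine ⟨?_, det_exp_of_traceless A ht⟩
  rw [Matrix.mem_unitaryGroup_iff, Matrix.star_eq_conjTranspose, ← Matrix.exp_conjTranspose, hA,
    ← Matrix.exp_add_of_commute A (-A) (Commute.neg_right (Commute.refl A))]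
  simp

/-- The element `e^{t τᵢ}` of `SU(2)`. -/
def SU2Basis.exp (B : SU2Basis) (i : Fin 3) (t : ℝ) : SU2 :=
  ⟨NormedSpace.exp ((t : ℂ) • B.τ i), exp_mem_SU2 _
    (by rw [Matrix.conjTranspose_smul, B.skew]; simp)
    (by rw [Matrix.trace_smul, B.traceless]; simp)⟩

/-! ### Smooth cylindrical functions on the one-loop graph -/

/-- Smooth functions of the holonomy `g = h_α ∈ SU(2)`, i.e. smooth cylindrical functions on the
graph with one vertex and one loop `α`: the restrictions to `SU(2)` of smooth functions of the
matrix entries (`SU(2)` is a closed submanifold of the space of matrices). -/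
def Cyl : Submodule ℂ (SU2 → ℂ) where
  carrier := {f | ∃ F : (Fin 2 → Fin 2 → ℂ) → ℂ, ContDiff ℝ ∞ F ∧ ∀ g : SU2, f g = F g.1}
  add_mem' := by
    rintro f₁ f₂ ⟨F₁, h₁, e₁⟩ ⟨F₂, h₂, e₂⟩
    exact ⟨fun M => F₁ M + F₂ M, h₁.add h₂, fun g => by simp [e₁, e₂]⟩
  zero_mem' := ⟨fun _ => 0, contDiff_const, fun g => rfl⟩
  smul_mem' := by
    rintro c f ⟨F, h, e⟩
    exact ⟨fun M => c * F M, contDiff_const.mul h, fun g => by simp [e]⟩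

theorem hasDerivAt_exp_entry (A : Matrix (Fin 2) (Fin 2) ℂ) (i j : Fin 2) :
    HasDerivAt (fun t : ℝ => (NormedSpace.exp ((t : ℂ) • A) : Matrix (Fin 2) (Fin 2) ℂ) i j)
      (A i j) 0 := by
  let _ : NormedRing (Matrix (Fin 2) (Fin 2) ℂ) := Matrix.linftyOpNormedRing
  let _ : NormedAlgebra ℂ (Matrix (Fin 2) (Fin 2) ℂ) := Matrix.linftyOpNormedAlgebra
  have h := hasDerivAt_exp_smul_const A (0 : ℂ)
  let L : Matrix (Fin 2) (Fin 2) ℂ →L[ℂ] ℂ :=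
    LinearMap.toContinuousLinearMap (Matrix.entryLinearMap ℂ ℂ i j)
  have h2 := (L.hasFDerivAt.comp_hasDerivAt (0 : ℂ) h)
  have h3 := HasDerivAt.comp_ofReal (z := 0) (by simpa using h2)
  simpa [L, Function.comp_def, Matrix.entryLinearMap] using! h3

theorem hasDerivAt_exp_mul (A M : Matrix (Fin 2) (Fin 2) ℂ) :
    HasDerivAt (fun t : ℝ => fun i j =>
      (NormedSpace.exp ((t : ℂ) • A) * M : Matrix (Fin 2) (Fin 2) ℂ) i j)
      (fun i j => (A * M) i j) 0 := by
  refine hasDerivAt_pi.2 fun i => hasDerivAt_pi.2 fun j => ?_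
  simp only [Matrix.mul_apply]
  exact HasDerivAt.fun_sum fun k _ => (hasDerivAt_exp_entry A i k).mul_const _

theorem hasDerivAt_mul_exp (A M : Matrix (Fin 2) (Fin 2) ℂ) :
    HasDerivAt (fun t : ℝ => fun i j =>
      (M * NormedSpace.exp ((t : ℂ) • A) : Matrix (Fin 2) (Fin 2) ℂ) i j)
      (fun i j => (M * A) i j) 0 := by
  refine hasDerivAt_pi.2 fun i => hasDerivAt_pi.2 fun j => ?_
  simp only [Matrix.mul_apply]
  exact HasDerivAt.fun_sum fun k _ => (hasDerivAt_exp_entry A k j).const_mul _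

theorem hasDerivAt_comp_curve {F : (Fin 2 → Fin 2 → ℂ) → ℂ} (hF : ContDiff ℝ ∞ F)
    {c : ℝ → Fin 2 → Fin 2 → ℂ} {v p : Fin 2 → Fin 2 → ℂ} (hc : HasDerivAt c v 0)
    (hp : c 0 = p) : HasDerivAt (fun t => F (c t)) (fderiv ℝ F p v) 0 := by
  have hd : DifferentiableAt ℝ F (c 0) := (hF.differentiable (by simp)).differentiableAt
  have := hd.hasFDerivAt.comp_hasDerivAt (0 : ℝ) hc
  rw [hp] at this
  exact this

theorem SU2Basis.hasDerivAt_left (B : SU2Basis) (i : Fin 3) {F : (Fin 2 → Fin 2 → ℂ) → ℂ}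
    (hF : ContDiff ℝ ∞ F) (g : SU2) :
    HasDerivAt (fun t : ℝ => F (B.exp i (-t) * g).1)
      (fderiv ℝ F g.1 (fun a b => (-B.τ i * g.1) a b)) 0 := by
  refine hasDerivAt_comp_curve hF (c := fun t => (B.exp i (-t) * g).1) ?_ ?_
  · have h := hasDerivAt_exp_mul (-B.τ i) g.1
    simpa [SU2Basis.exp] using h
  · simp [SU2Basis.exp]; rfl

theorem SU2Basis.hasDerivAt_right (B : SU2Basis) (i : Fin 3) {F : (Fin 2 → Fin 2 → ℂ) → ℂ}
    (hF : ContDiff ℝ ∞ F) (g : SU2) :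
    HasDerivAt (fun t : ℝ => F (g * B.exp i t).1)
      (fderiv ℝ F g.1 (fun a b => (g.1 * B.τ i) a b)) 0 := by
  refine hasDerivAt_comp_curve hF (c := fun t => (g * B.exp i t).1) ?_ ?_
  · have h := hasDerivAt_mul_exp (B.τ i) g.1
    simpa [SU2Basis.exp] using h
  · simp [SU2Basis.exp]; rfl

/-- The operator `J^i_{v,α_e}` of the ending segment of the loop (`v` is the target):
`(J f)(g) = i d/dt|_{t=0} f(e^{-tτᵢ} g)`. -/
def Jend (B : SU2Basis) (i : Fin 3) : Module.End ℂ Cyl where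
  toFun f := ⟨fun g => Complex.I * deriv (fun t : ℝ => f.1 (B.exp i (-t) * g)) 0, by
    obtain ⟨F, hF, e⟩ := f.2
    refine ⟨fun M => Complex.I * fderiv ℝ F M (fun a b => (-B.τ i * Matrix.of M) a b), ?_, ?_⟩
    · refine contDiff_const.mul ((hF.fderiv_right (m := ∞) (by simp)).clm_apply ?_)
      refine contDiff_pi.2 fun a => contDiff_pi.2 fun b => ?_
      simp only [Matrix.mul_apply, Matrix.of_apply]
      fun_prop
    · intro g
      simp only [e]
      rw [(B.hasDerivAt_left i hF g).deriv]
      rfl⟩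
  map_add' f₁ f₂ := by
    obtain ⟨F₁, hF₁, e₁⟩ := f₁.2
    obtain ⟨F₂, hF₂, e₂⟩ := f₂.2
    ext g
    have h₁ := B.hasDerivAt_left i hF₁ g
    have h₂ := B.hasDerivAt_left i hF₂ g
    simp only [Submodule.coe_add, Pi.add_apply, e₁, e₂]
    rw [h₁.deriv, h₂.deriv, (h₁.fun_add h₂).deriv, mul_add]
  map_smul' c f := by
    obtain ⟨F, hF, e⟩ := f.2
    ext g
    have h := B.hasDerivAt_left i hF g
    simp only [Submodule.coe_smul, Pi.smul_apply, e, RingHom.id_apply, smul_eq_mul]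
    rw [h.deriv, (h.const_mul c).deriv]
    ring

/-- The operator `J^i_{v,α_b}` of the beginning segment of the loop (`v` is the source):
`(J f)(g) = i d/dt|_{t=0} f(g e^{tτᵢ})`. -/
def Jbeg (B : SU2Basis) (i : Fin 3) : Module.End ℂ Cyl where
  toFun f := ⟨fun g => Complex.I * deriv (fun t : ℝ => f.1 (g * B.exp i t)) 0, by
    obtain ⟨F, hF, e⟩ := f.2
    refine ⟨fun M => Complex.I * fderiv ℝ F M (fun a b => (Matrix.of M * B.τ i) a b), ?_, ?_⟩
    · refine contDiff_const.mul ((hF.fderiv_right (m := ∞) (by simp)).clm_apply ?_)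
      refine contDiff_pi.2 fun a => contDiff_pi.2 fun b => ?_
      simp only [Matrix.mul_apply, Matrix.of_apply]
      fun_prop
    · intro g
      simp only [e]
      rw [(B.hasDerivAt_right i hF g).deriv]
      rfl⟩
  map_add' f₁ f₂ := by
    obtain ⟨F₁, hF₁, e₁⟩ := f₁.2
    obtain ⟨F₂, hF₂, e₂⟩ := f₂.2
    ext g
    have h₁ := B.hasDerivAt_right i hF₁ g
    have h₂ := B.hasDerivAt_right i hF₂ g
    simp only [Submodule.coe_add, Pi.add_apply, e₁, e₂]
    rw [h₁.deriv, h₂.deriv, (h₁.fun_add h₂).deriv, mul_add]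
  map_smul' c f := by
    obtain ⟨F, hF, e⟩ := f.2
    ext g
    have h := B.hasDerivAt_right i hF g
    simp only [Submodule.coe_smul, Pi.smul_apply, e, RingHom.id_apply, smul_eq_mul]
    rw [h.deriv, (h.const_mul c).deriv]
    ring

/-! ### Wigner matrices

A spin `j ∈ ½ℕ` is represented by the natural number `n = 2j`, and a magnetic number
`m ∈ {j, j-1, …, -j}` by the offset `a = j - m ∈ {0, …, n}`. -/

/-- The Wigner matrix `D^j(g)`, `n = 2j`, for any `2 × 2` matrix `g`: the `n`-th symmetric power
of `g` in the basis `x^{j+m} y^{j-m} / √((j+m)! (j-m)!)`, where `g` acts by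
`x ↦ g₀₀ x + g₁₀ y`, `y ↦ g₀₁ x + g₁₁ y` (written with `x = 1`, `y = X`); so `D^{1/2}(g) = g`. -/
def wignerD (n : ℕ) (g : Matrix (Fin 2) (Fin 2) ℂ) : Matrix (Fin (n + 1)) (Fin (n + 1)) ℂ :=
  Matrix.of fun b a =>
    ((Real.sqrt (((n - b.1).factorial * b.1.factorial : ℝ) /
        ((n - a.1).factorial * a.1.factorial)) : ℝ) : ℂ) *
      ((Polynomial.C (g 0 0) + Polynomial.C (g 1 0) * Polynomial.X) ^ (n - a.1) *
        (Polynomial.C (g 0 1) + Polynomial.C (g 1 1) * Polynomial.X) ^ a.1).coeff b.1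

/-- The differential `D'^{(l)}(A) = d/dt|_{t=0} D^l(e^{tA})`, `n = 2l`. -/
def wignerD' (n : ℕ) (A : Matrix (Fin 2) (Fin 2) ℂ) : Matrix (Fin (n + 1)) (Fin (n + 1)) ℂ :=
  Matrix.of fun b a => deriv (fun t : ℝ => wignerD n (NormedSpace.exp ((t : ℂ) • A)) b a) 0

theorem contDiff_coeff_pow {P : (Fin 2 → Fin 2 → ℂ) → Polynomial ℂ}
    (hP : ∀ b, ContDiff ℝ ∞ fun M => (P M).coeff b) (k : ℕ) :
    ∀ b, ContDiff ℝ ∞ fun M => (P M ^ k).coeff b := by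
  induction k with
  | zero => intro b; simpa using contDiff_const
  | succ k ih =>
    intro b
    simp only [pow_succ, Polynomial.coeff_mul]
    exact ContDiff.sum fun x _ => (ih _).mul (hP _)

theorem contDiff_coeff_linear (i : Fin 2) (b : ℕ) :
    ContDiff ℝ ∞ fun M : Fin 2 → Fin 2 → ℂ =>
      (Polynomial.C (M 0 i) + Polynomial.C (M 1 i) * Polynomial.X).coeff b := by
  rcases b with _ | _ | b
  · simp only [Polynomial.coeff_add, Polynomial.coeff_C_zero, Polynomial.mul_coeff_zero,
      Polynomial.coeff_X_zero, mul_zero, add_zero]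
    fun_prop
  · simp only [Polynomial.coeff_add, Polynomial.coeff_C_mul, zero_add, Polynomial.coeff_X_one,
      mul_one, Polynomial.coeff_C_succ]
    fun_prop
  · simp only [Polynomial.coeff_add, Polynomial.coeff_C_mul, Polynomial.coeff_C_succ,
      Polynomial.coeff_X]
    simpa using contDiff_const

theorem contDiff_wignerD (n : ℕ) (b a : Fin (n + 1)) :
    ContDiff ℝ ∞ fun M : Fin 2 → Fin 2 → ℂ => wignerD n (Matrix.of M) b a := by
  simp only [wignerD, Matrix.of_apply, Polynomial.coeff_mul]
  exact contDiff_const.mul (ContDiff.sum fun x _ =>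
    (contDiff_coeff_pow (contDiff_coeff_linear 0) _ _).mul
      (contDiff_coeff_pow (contDiff_coeff_linear 1) _ _))

/-- The smooth function `g ↦ Tr(D^j(g) T)`, `n = 2j`, for a fixed matrix `T`. -/
def traceState (n : ℕ) (T : Matrix (Fin (n + 1)) (Fin (n + 1)) ℂ) : Cyl :=
  ⟨fun g => (wignerD n g.1 * T).trace, fun M => (wignerD n (Matrix.of M) * T).trace, by
    simp only [Matrix.trace, Matrix.diag, Matrix.mul_apply]
    exact ContDiff.sum fun b _ => ContDiff.sum fun a _ =>
      (contDiff_wignerD n b a).mul contDiff_const, fun _ => rfl⟩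

/-! ### The Euclidean operator -/

/-- The multiplication operator `(h^i_α)^{(l)}`, `L = 2l`:
multiplication by `-3 / (l(l+1)(2l+1)) · Tr(D^l(g) D'^l(τᵢ))`. -/
def hMul (B : SU2Basis) (L : ℕ) (i : Fin 3) : Module.End ℂ Cyl where
  toFun f := ⟨fun g => -3 / ((L / 2 : ℂ) * (L / 2 + 1) * (L + 1)) *
      (traceState L (wignerD' L (B.τ i))).1 g * f.1 g, by
    obtain ⟨F, hF, e⟩ := f.2
    obtain ⟨G, hG, e'⟩ := (traceState L (wignerD' L (B.τ i))).2
    exact ⟨fun M => -3 / ((L / 2 : ℂ) * (L / 2 + 1) * (L + 1)) * G M * F M,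
      (contDiff_const.mul hG).mul hF, fun g => by
        change _ * _ * _ = _ * _ * _
        rw [e, e']⟩⟩
  map_add' f₁ f₂ := by
    ext g
    simp only [Submodule.coe_add, Pi.add_apply]
    ring
  map_smul' c f := by
    ext g
    simp only [Submodule.coe_smul, Pi.smul_apply, RingHom.id_apply, smul_eq_mul]
    ring

/-- The Euclidean operator `εᵢⱼₖ J^j_{v,α_e} J^k_{v,α_b} (h^i_α)^{(l)}`, `L = 2l`. -/
def HE (B : SU2Basis) (L : ℕ) : Module.End ℂ Cyl :=
  ∑ i, ∑ j, ∑ k, eps i j k • (Jend B j * Jbeg B k * hMul B L i)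

/-! ### The Lorentzian operator -/

/-- The graph of the function `Φ` of the family of operators `T`: the linear relation spanned by
the pairs `(f, Φ(x) f)`, where `f` is a joint eigenvector, `Tᵢ f = xᵢ f`, with `x ∈ S`. -/
def jointGraph {ι E : Type*} [AddCommGroup E] [Module ℂ E] (T : ι → Module.End ℂ E)
    (S : Set (ι → ℝ)) (Φ : (ι → ℝ) → ℝ) : Submodule ℂ (E × E) :=
  Submodule.span ℂ {p | ∃ x ∈ S, (∀ i, T i p.1 = (x i : ℂ) • p.1) ∧ p.2 = (Φ x : ℂ) • p.1}

/-- Joint eigenvectors with different eigenvalues are independent. -/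
theorem joint_eigen_indep {ι E : Type*} [AddCommGroup E] [Module ℂ E]
    (T : ι → Module.End ℂ E) (s : Finset (ι → ℝ)) :
    ∀ w : (ι → ℝ) → E, (∀ x ∈ s, ∀ i, T i (w x) = (x i : ℂ) • w x) → ∑ x ∈ s, w x = 0 →
      ∀ x ∈ s, w x = 0 := by
  classical
  induction s using Finset.induction_on with
  | empty => simp
  | insert y s hy ih =>
    intro w hw hsum
    have hz : ∀ x ∈ s, w x = 0 := by
      intro x hx
      have hxy : x ≠ y := fun h => hy (h ▸ hx)
      obtain ⟨i, hi⟩ := Function.ne_iff.1 hxy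
      have h := ih (fun z => ((z i : ℂ) - (y i : ℂ)) • w z) ?_ ?_ x hx
      · have : ((x i : ℂ) - (y i : ℂ)) ≠ 0 := by
          rw [sub_ne_zero]; exact_mod_cast hi
        exact (smul_eq_zero.1 h).resolve_left this
      · intro z hz k
        rw [map_smul, hw z (Finset.mem_insert_of_mem hz) k, smul_comm]
      · have h0 := congrArg (fun v => T i v - (y i : ℂ) • v) hsum
        simp only [map_sum, Finset.smul_sum, map_zero, smul_zero, sub_zero,
          ← Finset.sum_sub_distrib] at h0
        rw [Finset.sum_insert hy, hw y (Finset.mem_insert_self _ _) i, sub_self, zero_add] at h0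
        rw [← h0]
        refine Finset.sum_congr rfl fun z hz => ?_
        rw [hw z (Finset.mem_insert_of_mem hz) i, sub_smul]
    intro x hx
    rcases Finset.mem_insert.1 hx with rfl | hx
    · rwa [Finset.sum_insert hy, Finset.sum_eq_zero hz, add_zero] at hsum
    · exact hz x hx

/-- `jointGraph` is the graph of an operator. -/
theorem jointGraph_functional {ι E : Type*} [AddCommGroup E] [Module ℂ E]
    (T : ι → Module.End ℂ E) (S : Set (ι → ℝ)) (Φ : (ι → ℝ) → ℝ) (p : E × E)
    (hp : p ∈ jointGraph T S Φ) (h0 : p.1 = 0) : p.2 = 0 := by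
  classical
  have key : ∃ (s : Finset (ι → ℝ)) (w : (ι → ℝ) → E),
      (∀ x, ∀ i, T i (w x) = (x i : ℂ) • w x) ∧ (∀ x, x ∉ s → w x = 0) ∧
      p.1 = ∑ x ∈ s, w x ∧ p.2 = ∑ x ∈ s, (Φ x : ℂ) • w x := by
    unfold jointGraph at hp
    clear h0
    induction hp using Submodule.span_induction with
    | mem p hp =>
      obtain ⟨x, -, hx, hp2⟩ := hp
      refine ⟨{x}, fun z => if z = x then p.1 else 0, ?_, ?_, ?_, ?_⟩
      · intro z i
        by_cases hz : z = x
        · subst hz; simpa using hx i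
        · simp [hz]
      · intro z hz
        simp only [Finset.mem_singleton] at hz
        simp [hz]
      · simp
      · simp [hp2]
    | zero => exact ⟨∅, fun _ => 0, by simp, by simp, by simp, by simp⟩
    | add p q _ _ hp hq =>
      obtain ⟨s, w, h1, h2, h3, h4⟩ := hp
      obtain ⟨s', w', h1', h2', h3', h4'⟩ := hq
      refine ⟨s ∪ s', fun x => w x + w' x, fun x i => by simp [h1, h1'], ?_, ?_, ?_⟩
      · intro x hx
        rw [Finset.notMem_union] at hx
        simp [h2 x hx.1, h2' x hx.2]
      · rw [Finset.sum_add_distrib, Prod.fst_add, h3, h3']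
        congr 1
        · exact Finset.sum_subset Finset.subset_union_left fun x _ hx => h2 x hx
        · exact Finset.sum_subset Finset.subset_union_right fun x _ hx => h2' x hx
      · simp only [smul_add]
        rw [Finset.sum_add_distrib, Prod.snd_add, h4, h4']
        congr 1
        · exact Finset.sum_subset Finset.subset_union_left fun x _ hx => by rw [h2 x hx, smul_zero]
        · exact Finset.sum_subset Finset.subset_union_right fun x _ hx => by
            rw [h2' x hx, smul_zero]
    | smul c p _ hp =>
      obtain ⟨s, w, h1, h2, h3, h4⟩ := hp
      refine ⟨s, fun x => c • w x, fun x i => by rw [map_smul, h1, smul_comm], fun x hx => by simp [h2 x hx],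
        by simp [h3, Finset.smul_sum], ?_⟩
      rw [Prod.smul_snd, h4, Finset.smul_sum]
      exact Finset.sum_congr rfl fun x _ => smul_comm _ _ _
  obtain ⟨s, w, h1, -, h3, h4⟩ := key
  have hz := joint_eigen_indep T s w (fun x _ => h1 x) (h3 ▸ h0)
  rw [h4]
  exact Finset.sum_eq_zero fun x hx => by rw [hz x hx, smul_zero]

/-- The (joint) functional calculus `Φ(T)`: the operator whose domain is the span of the joint
eigenvectors of the family `T` with eigenvalues `x ∈ S`, acting on each of them as multiplication
by `Φ(x)`. -/
def jointCalc {ι E : Type*} [AddCommGroup E] [Module ℂ E] (T : ι → Module.End ℂ E)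
    (S : Set (ι → ℝ)) (Φ : (ι → ℝ) → ℝ) : E →ₗ.[ℂ] E :=
  (jointGraph T S Φ).toLinearPMap

/-- `δ^{ii'} (εᵢⱼₖ J^j_{α_b} J^k_{α_b}) (εᵢ'ⱼ'ₖ' J^{j'}_{α_e} J^{k'}_{α_e})`. -/
def crossOp (B : SU2Basis) : Module.End ℂ Cyl :=
  ∑ i, (∑ j, ∑ k, eps i j k • (Jbeg B j * Jbeg B k)) *
    (∑ j, ∑ k, eps i j k • (Jend B j * Jend B k))

/-- `δₖₗ J^k_{α_b} J^l_{α_e}`. -/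
def dotOp (B : SU2Basis) : Module.End ℂ Cyl := ∑ k, Jbeg B k * Jend B k

/-- `δₖₖ' J^k_{α_b} J^{k'}_{α_b}`. -/
def begSq (B : SU2Basis) : Module.End ℂ Cyl := ∑ k, Jbeg B k * Jbeg B k

/-- `δₖₖ' J^k_{α_e} J^{k'}_{α_e}`. -/
def endSq (B : SU2Basis) : Module.End ℂ Cyl := ∑ k, Jend B k * Jend B k

/-- The Lorentzian operator
`√X · (2π/𝔄 - π + arccos (P / (√Q √R)))`, as a function of the commuting operators
`X = crossOp`, `P = J_{α_b}·J_{α_e}`, `Q = J_{α_b}²`, `R = J_{α_e}²`, on the span of their joint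
eigenvectors for which the square roots are real. On the constant function (all eigenvalues `0`)
the quotient is read as `0`; its value does not matter since the prefactor `√X` vanishes there. -/
def HL (B : SU2Basis) (𝔄 : ℝ) : Cyl →ₗ.[ℂ] Cyl :=
  jointCalc ![crossOp B, dotOp B, begSq B, endSq B] {x | 0 ≤ x 0 ∧ 0 ≤ x 2 ∧ 0 ≤ x 3} fun x =>
    √(x 0) * (2 * Real.pi / 𝔄 - Real.pi + Real.arccos (x 1 / (√(x 2) * √(x 3))))

/-! ### Spin-network states on the loop -/

/-- `|j⟩`, `n = 2j`: the function `g ↦ Tr D^j(g)`. -/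
def ket (n : ℕ) : Cyl := traceState n 1

/-- The Wigner 3j-symbol `(j₁ j₂ j₃; m₁ m₂ m₃)` by the Racah formula, with `A = 2j₁`, `B = 2j₂`,
`C = 2j₃`, `a = j₁ - m₁`, `b = j₂ - m₂`, `c = j₃ - m₃`. With `p = j₁+j₂-j₃`, `q = j₁+j₃-j₂`,
`r = j₂+j₃-j₁`, the sum over `t` of the inverse products of six factorials is written, up to the
common factor `p! q! r!`, with binomial coefficients. -/
def threeJ (A B C a b c : ℕ) : ℝ :=
  if A ≤ B + C ∧ B ≤ A + C ∧ C ≤ A + B ∧ a ≤ A ∧ b ≤ B ∧ c ≤ C ∧ 2 * (a + b + c) = A + B + C then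
    (-1) ^ (c + (B + C - A) / 2) *
      √((a.factorial * (A - a).factorial * b.factorial * (B - b).factorial *
          c.factorial * (C - c).factorial : ℝ) /
        (((A + B + C) / 2 + 1).factorial * ((A + B - C) / 2).factorial *
          ((A + C - B) / 2).factorial * ((B + C - A) / 2).factorial)) *
      ∑ t ∈ Finset.range ((A + B - C) / 2 + 1),
        (if t ≤ a ∧ t ≤ B - b then
          (-1) ^ t * (((A + B - C) / 2).choose t : ℝ) * ((A + C - B) / 2).choose (a - t) *
            ((B + C - A) / 2).choose (B - b - t)
        else 0)
  else 0

/-- The trivalent intertwiner with legs `j`, `k`, `j` (`n = 2j`) and the free leg in the state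
`m = k - c`: the matrix `T_{μν} = (-1)^{j-μ} (j k j; -μ m ν)`. -/
def intertwiner (n k c : ℕ) : Matrix (Fin (n + 1)) (Fin (n + 1)) ℂ :=
  Matrix.of fun a b => (((-1) ^ a.1 * threeJ n (2 * k) n (n - a.1) c b.1 : ℝ) : ℂ)

/-- The gauge-variant state `||j,k⟩` (component `m = k - c` of the free leg of spin `k`), `n = 2j`:
the loop of spin `j` closed by the trivalent intertwiner. -/
def ketGV' (n k c : ℕ) : Cyl := traceState n (intertwiner n k c)

/-- The gauge-variant state `|j,k⟩ = √(2j+1) ||j,k⟩` (component `m = k - c`), `n = 2j`. -/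
def ketGV (n k c : ℕ) : Cyl := ((√(n + 1 : ℝ) : ℝ) : ℂ) • ketGV' n k c

end

/-!
The idea is to trade the `3j`-symbols for generating functions, on which the operators act by
elementary calculus.

**States.** Let `E(x)` be the nilpotent matrix with rows `(-x, 1)` and `(-x², x)`. Since
`1 + ξ E(x)` has determinant `1`, multiplicativity of the Wigner matrices (`wignerD_mul`) and the
character formula `Tr Dⁿ(M) = Sₙ(tr M)` on `SL(2, ℂ)`, with `Sₙ` the rescaled Chebyshev polynomial
of the second kind (`trace_wignerD_eq_eval_S`), give
`Tr (Dⁿ(g) Dⁿ(1 + ξ E(x))) = Sₙ(t + ξ u)` with `t = tr g` and `u = tr (g E(x))`.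
The matrix entries of the coefficient of `ξᵏ` in `Dⁿ(1 + ξ E(x))` are read off from the `n`-th power
of `1 + XY + ξ (1 + xX)(Y - x)`; expanding in `x`, one finds exactly the sums in Racah's formula
(`sum_smul_intertwiner`). Hence the states `‖j,k⟩` of all magnetic numbers together are, up to an
explicit normalisation, the coefficients of `x⁰, …, x²ᵏ` in `uᵏ Sₙ⁽ᵏ⁾(t)`, where `n = 2j`
(`sum_smul_ketGV'`).

**The Euclidean operator.** The brackets of the basis force `tr(τᵢτⱼ) = -δᵢⱼ/2`, which yields
completeness relations for sums over the basis. With these, `Ĥ^E` becomes a second-order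
differential operator in `t` and `u` (`HE_one_tracePoly_apply`), and on `uᵏ p(t)` it is
`uᵏ ((t² - 4) p' + (k² + 2k + 3) t p) / 2`. For `p = Sₙ⁽ᵏ⁾` the right hand side is a combination of
`Sₙ₊₁⁽ᵏ⁾` and `Sₙ₋₁⁽ᵏ⁾` by the three-term relations of the Chebyshev polynomials
(`Polynomial.Chebyshev.iterate_derivative_S_identity`); comparing coefficients of `x` gives the
action on every `‖j,k⟩`, and `k = 0` is the action on `|j⟩`.

**The Lorentzian operator.** On `|j⟩`, i.e. on `Sₙ(t)`, the operators `J_{α_b}²` and `J_{α_e}²` act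
by `j(j+1)`, which is the Chebyshev differential equation, and `J_{α_b}·J_{α_e}` acts by `-j(j+1)`.
The commutation relations turn each factor `εᵢⱼₖ J^j J^k` into `i Jⁱ`, so the operator under the
square root is `-J_{α_b}·J_{α_e}`. The argument of the arccosine is then `-1`, and `-π + arccos(-1)`
vanishes; for `j = 0` the prefactor vanishes.
-/

section

open Matrix Polynomial

/-! ### Traces over a basis of `su(2)` -/

namespace SU2Basis

theorem apply_one_one (B : SU2Basis) (i : Fin 3) : B.τ i 1 1 = -B.τ i 0 0 := by
  have h := B.traceless i
  rw [trace_fin_two] at h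
  linear_combination h

/-- The brackets of a basis, in cyclic order. -/
theorem bracket_cyclic (B : SU2Basis) :
    B.τ 1 * B.τ 2 - B.τ 2 * B.τ 1 = B.τ 0 ∧ B.τ 2 * B.τ 0 - B.τ 0 * B.τ 2 = B.τ 1 ∧
      B.τ 0 * B.τ 1 - B.τ 1 * B.τ 0 = B.τ 2 := by
  refine ⟨?_, ?_, ?_⟩
  · rw [B.bracket]; norm_num [Fin.sum_univ_three, eps]
  · rw [B.bracket]; norm_num [Fin.sum_univ_three, eps]
  · rw [B.bracket]; norm_num [Fin.sum_univ_three, eps]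

/-- The brackets determine the trace form: any basis with the structure constants `εᵢⱼₖ` is
orthogonal for it. The normalisation comes from
`[τ₀, [τ₀, τ₁]] = 2 tr(τ₀²) τ₁ - 2 tr(τ₀τ₁) τ₀` and `[τ₀, [τ₀, τ₁]] = -τ₁`. -/
theorem trace_mul_eq (B : SU2Basis) (i j : Fin 3) :
    (B.τ i * B.τ j).trace = if i = j then -1 / 2 else 0 := by
  obtain ⟨h0, h1, h2⟩ := B.bracket_cyclic
  have hne : B.τ 1 ≠ 0 := B.linearIndependent.ne_zero 1
  have hd : ∀ i, B.τ i 1 1 = -B.τ i 0 0 := B.apply_one_one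
  have e := fun (a b : Fin 2) => congrFun (congrFun h0 a) b
  have e' := fun (a b : Fin 2) => congrFun (congrFun h1 a) b
  have e'' := fun (a b : Fin 2) => congrFun (congrFun h2 a) b
  simp only [Matrix.sub_apply, mul_apply, Fin.sum_univ_two] at e e' e''
  have a0 := e 0 0
  have b0 := e 0 1
  have c0 := e 1 0
  have a1 := e' 0 0
  have b1 := e' 0 1
  have c1 := e' 1 0
  have a2 := e'' 0 0
  have b2 := e'' 0 1
  have c2 := e'' 1 0
  clear e e' e''
  simp only [hd] at a0 b0 c0 a1 b1 c1 a2 b2 c2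
  have q : ∀ i j, (B.τ i * B.τ j).trace =
      2 * B.τ i 0 0 * B.τ j 0 0 + B.τ i 0 1 * B.τ j 1 0 + B.τ i 1 0 * B.τ j 0 1 := by
    intro i j
    simp only [trace_fin_two, mul_apply, Fin.sum_univ_two, hd]
    ring
  have q01 : (B.τ 0 * B.τ 1).trace = 0 := by
    rw [q]
    linear_combination (-2) * B.τ 1 0 0 * a0 - B.τ 1 1 0 * b0 - B.τ 1 0 1 * c0
  have q02 : (B.τ 0 * B.τ 2).trace = 0 := by
    rw [q]
    linear_combination (-2) * B.τ 2 0 0 * a0 - B.τ 2 1 0 * b0 - B.τ 2 0 1 * c0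
  have q12 : (B.τ 1 * B.τ 2).trace = 0 := by
    rw [q]
    linear_combination (-2) * B.τ 2 0 0 * a1 - B.τ 2 1 0 * b1 - B.τ 2 0 1 * c1
  have q11 : (B.τ 1 * B.τ 1).trace = (B.τ 0 * B.τ 0).trace := by
    rw [q, q]
    linear_combination (-2) * B.τ 1 0 0 * a1 - B.τ 1 1 0 * b1 - B.τ 1 0 1 * c1 +
      2 * B.τ 0 0 0 * a0 + B.τ 0 1 0 * b0 + B.τ 0 0 1 * c0
  have q22 : (B.τ 2 * B.τ 2).trace = (B.τ 0 * B.τ 0).trace := by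
    rw [q, q]
    linear_combination (-2) * B.τ 2 0 0 * a2 - B.τ 2 1 0 * b2 - B.τ 2 0 1 * c2 +
      2 * B.τ 0 0 0 * a0 + B.τ 0 1 0 * b0 + B.τ 0 0 1 * c0
  have q00 : (B.τ 0 * B.τ 0).trace = -1 / 2 := by
    have hz : ∀ a b, (2 * (B.τ 0 * B.τ 0).trace + 1) * B.τ 1 a b = 0 := by
      intro a b
      have q01' := q01
      rw [q] at q01' ⊢
      fin_cases a <;> fin_cases b <;> simp only [Fin.mk_zero, Fin.mk_one, hd, Fin.isValue]
      · linear_combination (-1) * a1 + B.τ 0 0 1 * c2 - B.τ 0 1 0 * b2 + 2 * B.τ 0 0 0 * q01'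
      · linear_combination (-1) * b1 + 2 * B.τ 0 0 0 * b2 - 2 * B.τ 0 0 1 * a2 +
          2 * B.τ 0 0 1 * q01'
      · linear_combination (-1) * c1 - 2 * B.τ 0 0 0 * c2 + 2 * B.τ 0 1 0 * a2 +
          2 * B.τ 0 1 0 * q01'
      · linear_combination a1 - B.τ 0 0 1 * c2 + B.τ 0 1 0 * b2 - 2 * B.τ 0 0 0 * q01'
    by_contra hc
    refine hne (Matrix.ext fun a b => ?_)
    refine (mul_eq_zero.1 (hz a b)).resolve_left fun h => hc ?_
    linear_combination h / 2
  have comm : ∀ i j, (B.τ i * B.τ j).trace = (B.τ j * B.τ i).trace := fun i j =>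
    trace_mul_comm _ _
  fin_cases i <;> fin_cases j <;>
    simp [q00, q11, q22, q01, q02, q12, comm 1 0, comm 2 0, comm 2 1]

/-- Completeness of the basis, entry by entry. It is read off from orthonormality: a square
matrix with a left inverse has it as right inverse. -/
theorem sum_apply_mul_apply (B : SU2Basis) (a b c d : Fin 2) :
    ∑ k, B.τ k a b * B.τ k c d =
      (if a = b ∧ c = d then 1 / 4 else 0) - (if a = d ∧ b = c then 1 / 2 else 0) := by
  have hd : ∀ i, B.τ i 1 1 = -B.τ i 0 0 := B.apply_one_one
  let N : Matrix (Fin 3) (Fin 3) ℂ := of fun i => ![B.τ i 0 0, B.τ i 0 1, B.τ i 1 0]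
  let N' : Matrix (Fin 3) (Fin 3) ℂ :=
    of ![fun i => -4 * B.τ i 0 0, fun i => -2 * B.τ i 1 0, fun i => -2 * B.τ i 0 1]
  have hN : N * N' = 1 := by
    ext i j
    have h := B.trace_mul_eq i j
    simp only [trace_fin_two, mul_apply, Fin.sum_univ_two, hd] at h
    simp only [N, N', mul_apply, Fin.sum_univ_three, of_apply, one_apply]
    simp
    split_ifs at h ⊢ <;> linear_combination (-2) * h
  have hN' := mul_eq_one_comm.1 hN
  have e := fun i j => congrFun (congrFun hN' i) j
  simp only [N, N', mul_apply, of_apply, one_apply] at e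
  have e00 := e 0 0
  have e01 := e 0 1
  have e02 := e 0 2
  have e11 := e 1 1
  have e12 := e 1 2
  have e21 := e 2 1
  clear e
  simp [Fin.sum_univ_three] at e00 e01 e02 e11 e12 e21
  fin_cases a <;> fin_cases b <;> fin_cases c <;> fin_cases d <;>
    simp [Fin.sum_univ_three, hd] <;>
    first
    | linear_combination (-1 / 4 : ℂ) * e00
    | linear_combination (1 / 4 : ℂ) * e00
    | linear_combination (-1 / 4 : ℂ) * e01
    | linear_combination (1 / 4 : ℂ) * e01
    | linear_combination (-1 / 4 : ℂ) * e02
    | linear_combination (1 / 4 : ℂ) * e02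
    | linear_combination (-1 / 2 : ℂ) * e11
    | linear_combination (-1 / 2 : ℂ) * e12
    | linear_combination (-1 / 2 : ℂ) * e21

/-- Contracting with the basis projects, up to the factor `-1/2`, onto the traceless part. -/
theorem sum_trace_mul_smul (B : SU2Basis) (X : Matrix (Fin 2) (Fin 2) ℂ) :
    ∑ k, (X * B.τ k).trace • B.τ k = (-1 / 2 : ℂ) • (X - (X.trace / 2) • 1) := by
  have h := B.sum_apply_mul_apply
  simp only [Fin.sum_univ_three] at h
  ext a b
  have h1 := h 0 0 a b
  have h2 := h 0 1 a b
  have h3 := h 1 0 a b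
  have h4 := h 1 1 a b
  simp only [Fin.sum_univ_three, Matrix.add_apply, Matrix.smul_apply, smul_eq_mul,
    trace_fin_two, mul_apply, Fin.sum_univ_two, Matrix.sub_apply, one_apply]
  fin_cases a <;> fin_cases b <;> simp at h1 h2 h3 h4 ⊢ <;>
    linear_combination X 0 0 * h1 + X 1 0 * h2 + X 0 1 * h3 + X 1 1 * h4

theorem sum_mul_mul (B : SU2Basis) (X : Matrix (Fin 2) (Fin 2) ℂ) :
    ∑ k, B.τ k * X * B.τ k = (1 / 4 : ℂ) • X - (X.trace / 2) • 1 := by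
  have h := B.sum_apply_mul_apply
  simp only [Fin.sum_univ_three] at h
  ext a b
  have h1 := h a 0 0 b
  have h2 := h a 0 1 b
  have h3 := h a 1 0 b
  have h4 := h a 1 1 b
  simp only [Fin.sum_univ_three, Matrix.add_apply, Matrix.smul_apply, smul_eq_mul,
    trace_fin_two, mul_apply, Fin.sum_univ_two, Matrix.sub_apply, one_apply]
  fin_cases a <;> fin_cases b <;> simp at h1 h2 h3 h4 ⊢ <;>
    linear_combination X 0 0 * h1 + X 0 1 * h2 + X 1 0 * h3 + X 1 1 * h4

theorem sum_trace_mul_trace (B : SU2Basis) (X Y : Matrix (Fin 2) (Fin 2) ℂ) :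
    ∑ k, (X * B.τ k).trace * (Y * B.τ k).trace =
      (-1 / 2 : ℂ) * ((X * Y).trace - X.trace * Y.trace / 2) := by
  have h := congrArg (fun M => (Y * M).trace) (B.sum_trace_mul_smul X)
  simp only [Finset.mul_sum, trace_sum, Matrix.mul_smul, trace_smul, smul_eq_mul, mul_sub, mul_one,
    trace_sub] at h
  rw [h, trace_mul_comm Y X]
  ring

/-- Contracting `ε` with three traces gives a trace of a commutator. -/
theorem sum_eps_trace_trace_trace (B : SU2Basis) (X Y Z : Matrix (Fin 2) (Fin 2) ℂ) :
    ∑ i, ∑ j, ∑ k, eps i j k * ((X * B.τ i).trace * (Y * B.τ j).trace * (Z * B.τ k).trace) =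
      (1 / 4 : ℂ) * (Z * (X * Y - Y * X)).trace := by
  have h : ∀ i j, ∑ k, eps i j k * ((X * B.τ i).trace * (Y * B.τ j).trace * (Z * B.τ k).trace) =
      (Z * (((X * B.τ i).trace • B.τ i) * ((Y * B.τ j).trace • B.τ j) -
        ((Y * B.τ j).trace • B.τ j) * ((X * B.τ i).trace • B.τ i))).trace := by
    intro i j
    have hb := congrArg (fun M => (X * B.τ i).trace * (Y * B.τ j).trace * (Z * M).trace)
      (B.bracket i j)
    simp only [Finset.mul_sum, trace_sum, Matrix.mul_smul, trace_smul, smul_eq_mul] at hb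
    rw [show (∑ k, eps i j k * ((X * B.τ i).trace * (Y * B.τ j).trace * (Z * B.τ k).trace)) =
      ∑ k, (X * B.τ i).trace * (Y * B.τ j).trace * (eps i j k * (Z * B.τ k).trace) from
      Finset.sum_congr rfl fun k _ => by ring, ← hb]
    simp only [smul_mul_smul_comm, mul_sub, Matrix.mul_smul, trace_sub, trace_smul, smul_eq_mul]
    ring
  simp only [h]
  simp only [← trace_sum, ← Finset.mul_sum, Finset.sum_sub_distrib, ← Finset.sum_mul,
    sum_trace_mul_smul]
  simp only [sub_mul, mul_sub, smul_mul_assoc, Matrix.mul_smul, one_mul, mul_one,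
    smul_sub, trace_sub, trace_smul, smul_eq_mul]
  ring

theorem eps_rotate (i j k : Fin 3) : eps i j k = eps j k i := by
  simp only [eps]; ring

theorem sum_eps_mul (B : SU2Basis) (i : Fin 3) :
    ∑ j, ∑ k, eps i j k • (B.τ j * B.τ k) = B.τ i := by
  obtain ⟨h0, h1, h2⟩ := B.bracket_cyclic
  fin_cases i <;> norm_num [Fin.sum_univ_three, eps]
  · rw [← sub_eq_add_neg, h0]
  · rw [neg_add_eq_sub, h1]
  · rw [← sub_eq_add_neg, h2]; rfl

/-- The contraction of `ε` with `tr(X τᵢ)` and `tr(τⱼ X τₖ Y)`. -/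
theorem sum_eps_trace_mul_trace (B : SU2Basis) (X Y : Matrix (Fin 2) (Fin 2) ℂ) :
    ∑ i, ∑ j, ∑ k, eps i j k * ((X * B.τ i).trace * (B.τ j * X * B.τ k * Y).trace) =
      (-1 / 4 : ℂ) * X.trace * ((X * Y).trace - X.trace * Y.trace / 2) +
        (1 / 4 : ℂ) * Y.trace * ((X * X).trace - X.trace ^ 2 / 2) := by
  set X' : Matrix (Fin 2) (Fin 2) ℂ := (-1 / 2 : ℂ) • (X - (X.trace / 2) • 1) with hX'
  -- summing over `j` first turns `τⱼ` into the commutator `[τₖ, τᵢ]`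
  have h : ∀ i k, ∑ j, eps i j k * ((X * B.τ i).trace * (B.τ j * X * B.τ k * Y).trace) =
      ((B.τ k * ((X * B.τ i).trace • B.τ i) - ((X * B.τ i).trace • B.τ i) * B.τ k) * X *
        B.τ k * Y).trace := by
    intro i k
    have hb := congrArg (fun M => (X * B.τ i).trace * (M * X * B.τ k * Y).trace) (B.bracket k i)
    simp only [Finset.sum_mul, Finset.mul_sum, trace_sum, smul_mul_assoc, trace_smul,
      smul_eq_mul] at hb
    rw [Matrix.mul_smul, smul_mul_assoc, ← smul_sub, smul_mul_assoc, smul_mul_assoc, smul_mul_assoc,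
      trace_smul, smul_eq_mul, hb]
    refine Finset.sum_congr rfl fun j _ => ?_
    rw [eps_rotate k i j]
    ring
  have h' : ∀ k, ∑ i, ∑ j, eps i j k * ((X * B.τ i).trace * (B.τ j * X * B.τ k * Y).trace) =
      ((B.τ k * (X' * X) * B.τ k) * Y - X' * (B.τ k * X * B.τ k) * Y).trace := by
    intro k
    simp only [h, ← trace_sum, ← Finset.sum_mul, Finset.sum_sub_distrib, ← Finset.mul_sum,
      sum_trace_mul_smul]
    rw [← hX']
    simp only [sub_mul, mul_assoc]
  calc _ = ∑ k, ∑ i, ∑ j, eps i j k *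
        ((X * B.τ i).trace * (B.τ j * X * B.τ k * Y).trace) := by
        rw [Finset.sum_congr rfl fun i _ => Finset.sum_comm, Finset.sum_comm]
    _ = _ := by
        simp only [h', ← trace_sum, Finset.sum_sub_distrib, ← Finset.sum_mul, ← Finset.mul_sum,
          sum_mul_mul]
        simp only [hX', smul_mul_assoc, Matrix.mul_smul, sub_mul, mul_sub, trace_sub, trace_smul,
          smul_eq_mul, one_mul, mul_one]
        ring

end SU2Basis

/-! ### The Euclidean operator as a differential operator -/

namespace SU2Basis

theorem hasDerivAt_trace_left (B : SU2Basis) (j : Fin 3) (g : SU2)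
    (M : Matrix (Fin 2) (Fin 2) ℂ) :
    HasDerivAt (fun t : ℝ => ((B.exp j (-t) * g).1 * M).trace) (-(B.τ j * g.1 * M).trace) 0 := by
  have h := hasDerivAt_exp_mul (-B.τ j) g.1
  simp only [hasDerivAt_pi] at h
  have h' : HasDerivAt (fun t : ℝ =>
      ∑ a, ∑ b, (NormedSpace.exp ((t : ℂ) • -B.τ j) * g.1) a b * M b a)
      (∑ a, ∑ b, (-B.τ j * g.1) a b * M b a) 0 :=
    HasDerivAt.fun_sum fun a _ => HasDerivAt.fun_sum fun b _ => (h a b).mul_const _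
  have e : -(B.τ j * g.1 * M).trace = ∑ a, ∑ b, (-B.τ j * g.1) a b * M b a := by
    rw [← trace_neg, ← Matrix.neg_mul, ← Matrix.neg_mul]
    rfl
  rw [e]
  convert h' using 2 with t
  simp [SU2Basis.exp, trace, Matrix.mul_apply]

theorem hasDerivAt_trace_right (B : SU2Basis) (k : Fin 3) (g : SU2)
    (M : Matrix (Fin 2) (Fin 2) ℂ) :
    HasDerivAt (fun t : ℝ => ((g * B.exp k t).1 * M).trace) ((g.1 * B.τ k * M).trace) 0 := by
  have h := hasDerivAt_mul_exp (B.τ k) g.1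
  simp only [hasDerivAt_pi] at h
  have h' : HasDerivAt (fun t : ℝ =>
      ∑ a, ∑ b, (g.1 * NormedSpace.exp ((t : ℂ) • B.τ k)) a b * M b a)
      (∑ a, ∑ b, (g.1 * B.τ k) a b * M b a) 0 :=
    HasDerivAt.fun_sum fun a _ => HasDerivAt.fun_sum fun b _ => (h a b).mul_const _
  exact h'

theorem exp_zero (B : SU2Basis) (i : Fin 3) : B.exp i 0 = 1 := by
  apply Subtype.ext
  simp [SU2Basis.exp]

/-- The derivative along `e^{-tτⱼ} g`, expressed by the operator of the ending segment. -/
theorem hasDerivAt_cyl_left (B : SU2Basis) (j : Fin 3) (f : Cyl) (g : SU2) :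
    HasDerivAt (fun t : ℝ => f.1 (B.exp j (-t) * g)) (-Complex.I * (Jend B j f).1 g) 0 := by
  obtain ⟨F, hF, e⟩ := f.2
  have h := B.hasDerivAt_left j hF g
  simp only [← e] at h
  have e' : -Complex.I * (Jend B j f).1 g = deriv (fun t : ℝ => f.1 (B.exp j (-t) * g)) 0 := by
    change -Complex.I * (Complex.I * deriv (fun t : ℝ => f.1 (B.exp j (-t) * g)) 0) = _
    rw [← mul_assoc]
    simp
  rw [e']
  exact h.differentiableAt.hasDerivAt

/-- The derivative along `g e^{tτₖ}`, expressed by the operator of the beginning segment. -/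
theorem hasDerivAt_cyl_right (B : SU2Basis) (k : Fin 3) (f : Cyl) (g : SU2) :
    HasDerivAt (fun t : ℝ => f.1 (g * B.exp k t)) (-Complex.I * (Jbeg B k f).1 g) 0 := by
  obtain ⟨F, hF, e⟩ := f.2
  have h := B.hasDerivAt_right k hF g
  simp only [← e] at h
  have e' : -Complex.I * (Jbeg B k f).1 g = deriv (fun t : ℝ => f.1 (g * B.exp k t)) 0 := by
    change -Complex.I * (Complex.I * deriv (fun t : ℝ => f.1 (g * B.exp k t)) 0) = _
    rw [← mul_assoc]
    simp
  rw [e']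
  exact h.differentiableAt.hasDerivAt

theorem Jend_apply_of_hasDerivAt (B : SU2Basis) (j : Fin 3) (f : Cyl) (g : SU2) {d : ℂ}
    (h : HasDerivAt (fun t : ℝ => f.1 (B.exp j (-t) * g)) d 0) :
    (Jend B j f).1 g = Complex.I * d := by
  rw [← h.deriv]; rfl

theorem Jbeg_apply_of_hasDerivAt (B : SU2Basis) (k : Fin 3) (f : Cyl) (g : SU2) {d : ℂ}
    (h : HasDerivAt (fun t : ℝ => f.1 (g * B.exp k t)) d 0) :
    (Jbeg B k f).1 g = Complex.I * d := by
  rw [← h.deriv]; rfl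

end SU2Basis

theorem wignerD_one_eq (g : Matrix (Fin 2) (Fin 2) ℂ) : wignerD 1 g = g := by
  ext a b
  fin_cases a <;> fin_cases b <;> simp [wignerD, coeff_X, coeff_C]

theorem wignerD'_one_eq (A : Matrix (Fin 2) (Fin 2) ℂ) : wignerD' 1 A = A := by
  ext a b
  simp only [wignerD', wignerD_one_eq]
  exact (hasDerivAt_exp_entry A a b).deriv

theorem hMul_one_apply (B : SU2Basis) (i : Fin 3) (f : Cyl) (g : SU2) :
    (hMul B 1 i f).1 g = -2 * (g.1 * B.τ i).trace * f.1 g := by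
  change -3 / (((1 : ℕ) / 2 : ℂ) * ((1 : ℕ) / 2 + 1) * ((1 : ℕ) + 1)) *
    (wignerD 1 g.1 * wignerD' 1 (B.τ i)).trace * f.1 g = _
  rw [wignerD_one_eq, wignerD'_one_eq]
  norm_num

theorem Jend_Jbeg_hMul_apply (B : SU2Basis) (i j k : Fin 3) (f : Cyl) (g : SU2) :
    (Jend B j (Jbeg B k (hMul B 1 i f))).1 g =
      -2 * ((B.τ j * g.1 * (B.τ k * B.τ i)).trace * f.1 g +
        Complex.I * (g.1 * (B.τ k * B.τ i)).trace * (Jend B j f).1 g -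
        Complex.I * (B.τ j * g.1 * B.τ i).trace * (Jbeg B k f).1 g +
        (g.1 * B.τ i).trace * (Jend B j (Jbeg B k f)).1 g) := by
  have h1 : ∀ g : SU2, (Jbeg B k (hMul B 1 i f)).1 g =
      -2 * (Complex.I * (g.1 * (B.τ k * B.τ i)).trace * f.1 g +
        (g.1 * B.τ i).trace * (Jbeg B k f).1 g) := by
    intro g
    have hd := ((B.hasDerivAt_trace_right k g (B.τ i)).const_mul (-2)).mul
      (B.hasDerivAt_cyl_right k f g)
    simp only [B.exp_zero, mul_one] at hd
    rw [B.Jbeg_apply_of_hasDerivAt (d := _) k _ g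
      (hd.congr_of_eventuallyEq (.of_forall fun t => hMul_one_apply B i f _))]
    rw [Matrix.mul_assoc]
    linear_combination (2 * (g.1 * B.τ i).trace * (Jbeg B k f).1 g) * Complex.I_sq
  have hd := ((((B.hasDerivAt_trace_left j g (B.τ k * B.τ i)).const_mul Complex.I).mul
    (B.hasDerivAt_cyl_left j f g)).add ((B.hasDerivAt_trace_left j g (B.τ i)).mul
    (B.hasDerivAt_cyl_left j (Jbeg B k f) g))).const_mul (-2)
  simp only [neg_zero, B.exp_zero, one_mul] at hd
  rw [B.Jend_apply_of_hasDerivAt (d := _) j _ g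
    (hd.congr_of_eventuallyEq (.of_forall fun t => h1 _))]
  linear_combination (2 * (B.τ j * g.1 * (B.τ k * B.τ i)).trace * f.1 g +
    2 * Complex.I * (g.1 * (B.τ k * B.τ i)).trace * (Jend B j f).1 g +
    2 * (g.1 * B.τ i).trace * (Jend B j (Jbeg B k f)).1 g) * Complex.I_sq

theorem HE_one_apply_eq_sum (B : SU2Basis) (f : Cyl) (g : SU2) :
    (HE B 1 f).1 g =
      ∑ i, ∑ j, ∑ k, eps i j k * (Jend B j (Jbeg B k (hMul B 1 i f))).1 g := by
  simp [HE, LinearMap.sum_apply, Finset.sum_apply]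

/-- The Euclidean operator with `l = 1/2` as a differential operator: the multiplication by
`-2 tr(g τᵢ)` is moved to the left. -/
theorem HE_one_apply (B : SU2Basis) (f : Cyl) (g : SU2) :
    (HE B 1 f).1 g = 3 / 2 * g.1.trace * f.1 g +
      2 * Complex.I * ∑ k, (g.1 * B.τ k).trace * (Jbeg B k f).1 g -
      2 * Complex.I * ∑ j, (g.1 * B.τ j).trace * (Jend B j f).1 g -
      2 * ∑ i, ∑ j, ∑ k, eps i j k *
        ((g.1 * B.τ i).trace * (Jend B j (Jbeg B k f)).1 g) := by
  -- the terms where both, only the second, or only the first derivative fall on `tr(g τᵢ)`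
  have hA : ∑ i, ∑ j, ∑ k, eps i j k * (B.τ j * g.1 * (B.τ k * B.τ i)).trace =
      -3 / 4 * g.1.trace := by
    have h : ∀ j, ∑ i, ∑ k, eps i j k * (B.τ j * g.1 * (B.τ k * B.τ i)).trace =
        (B.τ j * g.1 * B.τ j).trace := by
      intro j
      have hj := congrArg (fun M => (B.τ j * g.1 * M).trace) (B.sum_eps_mul j)
      simp only [Finset.mul_sum, trace_sum, Matrix.mul_smul, trace_smul, smul_eq_mul] at hj
      rw [Finset.sum_comm, ← hj]
      refine Finset.sum_congr rfl fun k _ => Finset.sum_congr rfl fun i _ => ?_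
      rw [SU2Basis.eps_rotate]
    rw [Finset.sum_comm]
    simp only [h, ← trace_sum, B.sum_mul_mul]
    simp only [trace_sub, trace_smul, trace_one, smul_eq_mul, Fintype.card_fin]
    push_cast
    ring
  have hB : ∀ k, ∑ i, ∑ j, eps i j k * (B.τ j * g.1 * B.τ i).trace = (g.1 * B.τ k).trace := by
    intro k
    conv_rhs => rw [← B.sum_eps_mul k]
    simp only [Finset.mul_sum, trace_sum, Matrix.mul_smul, trace_smul, smul_eq_mul]
    refine Finset.sum_congr rfl fun i _ => Finset.sum_congr rfl fun j _ => ?_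
    rw [SU2Basis.eps_rotate k i j, Matrix.mul_assoc, trace_mul_comm, Matrix.mul_assoc]
  have hC : ∀ j, ∑ i, ∑ k, eps i j k * (g.1 * (B.τ k * B.τ i)).trace = (g.1 * B.τ j).trace := by
    intro j
    rw [Finset.sum_comm]
    conv_rhs => rw [← B.sum_eps_mul j]
    simp only [Finset.mul_sum, trace_sum, Matrix.mul_smul, trace_smul, smul_eq_mul]
    refine Finset.sum_congr rfl fun i _ => Finset.sum_congr rfl fun j _ => ?_
    rw [SU2Basis.eps_rotate]
  have hB' : ∑ i, ∑ j, ∑ k, eps i j k * ((B.τ j * g.1 * B.τ i).trace * (Jbeg B k f).1 g) =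
      ∑ k, (g.1 * B.τ k).trace * (Jbeg B k f).1 g := by
    simp only [← hB, Finset.sum_mul]
    rw [Finset.sum_congr rfl fun i _ => Finset.sum_comm, Finset.sum_comm]
    simp only [mul_assoc]
  have hC' : ∑ i, ∑ j, ∑ k, eps i j k * ((g.1 * (B.τ k * B.τ i)).trace * (Jend B j f).1 g) =
      ∑ j, (g.1 * B.τ j).trace * (Jend B j f).1 g := by
    simp only [← hC, Finset.sum_mul]
    rw [Finset.sum_comm]
    simp only [mul_assoc]
  rw [HE_one_apply_eq_sum, ← hB', ← hC']
  have hA' : 3 / 2 * g.1.trace * f.1 g = -2 * f.1 g *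
      ∑ i, ∑ j, ∑ k, eps i j k * (B.τ j * g.1 * (B.τ k * B.τ i)).trace := by
    rw [hA]; ring
  rw [hA']
  simp only [Finset.mul_sum, ← Finset.sum_add_distrib, ← Finset.sum_sub_distrib]
  refine Finset.sum_congr rfl fun i _ => Finset.sum_congr rfl fun j _ =>
    Finset.sum_congr rfl fun k _ => ?_
  rw [Jend_Jbeg_hMul_apply]
  ring

/-! ### The Euclidean operator on functions of two traces -/

/-- The smooth function `g ↦ q(tr(gE)) p(tr g)` on `SU(2)`. -/
noncomputable def tracePoly (E : Matrix (Fin 2) (Fin 2) ℂ) (q p : ℂ[X]) : Cyl :=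
  ⟨fun g => q.eval (g.1 * E).trace * p.eval g.1.trace,
    fun M => q.eval (Matrix.of M * E).trace * p.eval (Matrix.of M).trace, by
      have hp : ∀ p : ℂ[X], ContDiff ℝ ∞ fun z : ℂ => p.eval z := fun p =>
        by
        simpa only [← coe_aeval_eq_eval] using p.contDiff_aeval (𝕜 := ℂ) ∞ |>.restrict_scalars ℝ
      refine ((hp q).comp ?_).mul ((hp p).comp ?_)
      · simp only [trace_fin_two, mul_apply, of_apply, Fin.sum_univ_two]
        fun_prop
      · simp only [trace_fin_two, of_apply]
        fun_prop, fun _ => rfl⟩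

theorem tracePoly_apply (E : Matrix (Fin 2) (Fin 2) ℂ) (q p : ℂ[X]) (g : SU2) :
    (tracePoly E q p).1 g = q.eval (g.1 * E).trace * p.eval g.1.trace := rfl

theorem hasDerivAt_eval_comp {v : ℝ → ℂ} {d v₀ : ℂ} (q : ℂ[X]) (h : HasDerivAt v d 0)
    (h0 : v 0 = v₀) :
    HasDerivAt (fun t : ℝ => q.eval (v t)) (q.derivative.eval v₀ * d) 0 := by
  subst h0
  exact (q.hasDerivAt (v 0)).comp (0 : ℝ) h

section

variable (B : SU2Basis) (E : Matrix (Fin 2) (Fin 2) ℂ) (q p : ℂ[X]) (g : SU2)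

theorem Jbeg_tracePoly_apply (k : Fin 3) :
    (Jbeg B k (tracePoly E q p)).1 g = Complex.I *
      ((g.1 * B.τ k * E).trace * (tracePoly E q.derivative p).1 g +
        (g.1 * B.τ k).trace * (tracePoly E q p.derivative).1 g) := by
  have h1 := B.hasDerivAt_trace_right k g E
  have h2 := B.hasDerivAt_trace_right k g 1
  simp only [Matrix.mul_one] at h2
  have hd := (hasDerivAt_eval_comp (v₀ := (g.1 * E).trace) q h1 (by simp [B.exp_zero])).mul
    (hasDerivAt_eval_comp (v₀ := g.1.trace) p h2 (by simp [B.exp_zero]))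
  simp only [B.exp_zero, mul_one] at hd
  rw [B.Jbeg_apply_of_hasDerivAt k _ g hd]
  simp only [tracePoly_apply]
  ring

theorem Jend_tracePoly_apply (j : Fin 3) :
    (Jend B j (tracePoly E q p)).1 g = -Complex.I *
      ((B.τ j * g.1 * E).trace * (tracePoly E q.derivative p).1 g +
        (B.τ j * g.1).trace * (tracePoly E q p.derivative).1 g) := by
  have h1 := B.hasDerivAt_trace_left j g E
  have h2 := B.hasDerivAt_trace_left j g 1
  simp only [Matrix.mul_one] at h2
  have hd := (hasDerivAt_eval_comp (v₀ := (g.1 * E).trace) q h1 (by simp [B.exp_zero])).mul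
    (hasDerivAt_eval_comp (v₀ := g.1.trace) p h2 (by simp [B.exp_zero]))
  simp only [B.exp_zero, one_mul, neg_zero] at hd
  rw [B.Jend_apply_of_hasDerivAt j _ g hd]
  simp only [tracePoly_apply]
  ring

theorem Jend_Jbeg_tracePoly_apply (j k : Fin 3) :
    (Jend B j (Jbeg B k (tracePoly E q p))).1 g =
      (B.τ j * g.1 * (B.τ k * E)).trace * (tracePoly E q.derivative p).1 g +
      (B.τ j * g.1 * B.τ k).trace * (tracePoly E q p.derivative).1 g +
      (g.1 * (B.τ k * E)).trace * ((B.τ j * g.1 * E).trace *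
          (tracePoly E q.derivative.derivative p).1 g +
        (B.τ j * g.1).trace * (tracePoly E q.derivative p.derivative).1 g) +
      (g.1 * B.τ k).trace * ((B.τ j * g.1 * E).trace *
          (tracePoly E q.derivative p.derivative).1 g +
        (B.τ j * g.1).trace * (tracePoly E q p.derivative.derivative).1 g) := by
  have hd := (((B.hasDerivAt_trace_left j g (B.τ k * E)).mul
    (B.hasDerivAt_cyl_left j (tracePoly E q.derivative p) g)).add
    ((B.hasDerivAt_trace_left j g (B.τ k)).mul
    (B.hasDerivAt_cyl_left j (tracePoly E q p.derivative) g))).const_mul Complex.I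
  simp only [B.exp_zero, one_mul, neg_zero] at hd
  rw [B.Jend_apply_of_hasDerivAt (d := _) j _ g (hd.congr_of_eventuallyEq (.of_forall fun t => by
    beta_reduce
    rw [Jbeg_tracePoly_apply, Matrix.mul_assoc (B.exp j (-t) * g).1]; rfl))]
  simp only [Jend_tracePoly_apply]
  generalize (tracePoly E q.derivative p).1 g = f1
  generalize (tracePoly E q p.derivative).1 g = f2
  generalize (tracePoly E q.derivative.derivative p).1 g = f3
  generalize (tracePoly E q.derivative p.derivative).1 g = f4
  generalize (tracePoly E q p.derivative.derivative).1 g = f5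
  generalize (B.τ j * g.1 * (B.τ k * E)).trace = a1
  generalize (B.τ j * g.1 * B.τ k).trace = a2
  generalize (g.1 * (B.τ k * E)).trace = a3
  generalize (g.1 * B.τ k).trace = a4
  generalize (B.τ j * g.1 * E).trace = a5
  generalize (B.τ j * g.1).trace = a6
  ring_nf
  simp only [Complex.I_sq, show Complex.I ^ 4 = 1 from Complex.I_pow_four]
  ring

end

/-! ### Traces of `2 × 2` matrices -/

/-- Cayley-Hamilton in dimension two. -/
theorem mul_self_fin_two (A : Matrix (Fin 2) (Fin 2) ℂ) :
    A * A = A.trace • A - A.det • (1 : Matrix (Fin 2) (Fin 2) ℂ) := by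
  ext a b
  fin_cases a <;> fin_cases b <;>
    simp [Matrix.mul_apply, trace_fin_two, det_fin_two, Fin.sum_univ_two] <;> ring

theorem SU2_mul_self (g : SU2) : g.1 * g.1 = g.1.trace • g.1 - 1 := by
  have h := mul_self_fin_two g.1
  rwa [(mem_specialUnitaryGroup_iff.1 g.2).2, one_smul] at h

/-- The Euclidean operator on `q(u) p(t)`, `u = tr(gE)`, `t = tr g`, for a nilpotent `E`. -/
theorem HE_one_tracePoly_apply (B : SU2Basis) {E : Matrix (Fin 2) (Fin 2) ℂ} (hE : E.trace = 0)
    (hE' : E.det = 0) (q p : ℂ[X]) (g : SU2) :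
    (HE B 1 (tracePoly E q p)).1 g =
      3 / 2 * g.1.trace * (tracePoly E q p).1 g +
      3 / 2 * g.1.trace * (g.1 * E).trace * (tracePoly E q.derivative p).1 g +
      (g.1.trace ^ 2 - 4) / 2 * (tracePoly E q p.derivative).1 g +
      g.1.trace * (g.1 * E).trace ^ 2 / 2 * (tracePoly E q.derivative.derivative p).1 g := by
  have hg := SU2_mul_self g
  have hgg : (g.1 * g.1).trace = g.1.trace ^ 2 - 2 := by
    rw [hg, trace_sub, trace_smul, trace_one, smul_eq_mul, Fintype.card_fin]; push_cast; ring
  have hggE : (g.1 * g.1 * E).trace = g.1.trace * (g.1 * E).trace := by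
    rw [hg, Matrix.sub_mul, trace_sub, smul_mul, trace_smul, one_mul, hE, smul_eq_mul]; ring
  have hgEgE : (g.1 * E * (g.1 * E)).trace = (g.1 * E).trace ^ 2 := by
    rw [mul_self_fin_two, det_mul, hE', mul_zero, zero_smul, sub_zero, trace_smul, smul_eq_mul]
    ring
  have hEE : E * E = 0 := by rw [mul_self_fin_two, hE, hE']; simp
  have r1 : ∀ k, (g.1 * B.τ k * E).trace = (E * g.1 * B.τ k).trace := fun k => by
    rw [trace_mul_comm, Matrix.mul_assoc]
  have r1' : ∀ k, (g.1 * (B.τ k * E)).trace = (E * g.1 * B.τ k).trace := fun k => by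
    rw [← Matrix.mul_assoc, r1]
  have r2 : ∀ j, (B.τ j * g.1 * E).trace = (g.1 * E * B.τ j).trace := fun j => by
    rw [Matrix.mul_assoc, trace_mul_comm]
  have r3 : ∀ j, (B.τ j * g.1).trace = (g.1 * B.τ j).trace := fun j => trace_mul_comm _ _
  have s1 := B.sum_trace_mul_trace g.1 (E * g.1)
  have s2 := B.sum_trace_mul_trace g.1 g.1
  have s3 := B.sum_trace_mul_trace g.1 (g.1 * E)
  have s4 := B.sum_eps_trace_mul_trace g.1 E
  have s5 := B.sum_eps_trace_mul_trace g.1 1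
  have s6 := B.sum_eps_trace_trace_trace g.1 (g.1 * E) (E * g.1)
  have s7 := B.sum_eps_trace_trace_trace g.1 g.1 (E * g.1)
  have s8 := B.sum_eps_trace_trace_trace g.1 (g.1 * E) g.1
  have s9 := B.sum_eps_trace_trace_trace g.1 g.1 g.1
  have c1 : (g.1 * (E * g.1)).trace = (g.1 * g.1 * E).trace := by
    rw [trace_mul_comm, Matrix.mul_assoc, trace_mul_comm]
  have c2 : (E * g.1).trace = (g.1 * E).trace := trace_mul_comm _ _
  have c3 : (E * g.1 * (g.1 * (g.1 * E) - g.1 * E * g.1)).trace =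
      -(g.1.trace * (g.1 * E).trace ^ 2) := by
    have e1 : (E * g.1 * (g.1 * (g.1 * E))).trace = 0 := by
      rw [trace_mul_comm, Matrix.mul_assoc, Matrix.mul_assoc, ← Matrix.mul_assoc E E, hEE]
      simp
    have e2 : (E * g.1 * (g.1 * E * g.1)).trace = (g.1 * g.1 * (E * g.1 * E)).trace := by
      rw [trace_mul_comm, ← Matrix.mul_assoc, trace_mul_comm]
      simp only [Matrix.mul_assoc]
    rw [Matrix.mul_sub, trace_sub, e1, e2, hg, Matrix.sub_mul, trace_sub, smul_mul, trace_smul,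
      one_mul, ← hgEgE]
    have e3 : (E * g.1 * E).trace = 0 := by
      rw [trace_mul_comm, ← Matrix.mul_assoc, hEE]; simp
    rw [e3]
    simp only [Matrix.mul_assoc, smul_eq_mul]
    ring
  have c4 : (g.1 * (g.1 * (g.1 * E) - g.1 * E * g.1)).trace = 0 := by
    rw [Matrix.mul_sub, trace_sub, ← Matrix.mul_assoc g.1 g.1 E, ← Matrix.mul_assoc g.1 (g.1 * E),
      ← Matrix.mul_assoc g.1 g.1 E, trace_mul_comm g.1 (g.1 * g.1 * E),
      trace_mul_comm (g.1 * g.1 * E), sub_eq_zero]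
  rw [c1, c2, hggE] at s1
  rw [hgg] at s2
  rw [← Matrix.mul_assoc, hggE] at s3
  rw [hE, hgg] at s4
  simp only [Matrix.mul_one, hgg, trace_one, Fintype.card_fin, Nat.cast_ofNat] at s5
  rw [c3] at s6
  simp only [sub_self, mul_zero, trace_zero] at s7 s9
  rw [c4] at s8
  have hb : ∑ k, (g.1 * B.τ k).trace * (Jbeg B k (tracePoly E q p)).1 g = Complex.I *
      ((tracePoly E q.derivative p).1 g * ∑ k, (g.1 * B.τ k).trace * (E * g.1 * B.τ k).trace +
       (tracePoly E q p.derivative).1 g * ∑ k, (g.1 * B.τ k).trace * (g.1 * B.τ k).trace) := by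
    simp only [Jbeg_tracePoly_apply, r1, Finset.mul_sum, ← Finset.sum_add_distrib]
    exact Finset.sum_congr rfl fun k _ => by ring
  have hc : ∑ j, (g.1 * B.τ j).trace * (Jend B j (tracePoly E q p)).1 g = -Complex.I *
      ((tracePoly E q.derivative p).1 g * ∑ k, (g.1 * B.τ k).trace * (g.1 * E * B.τ k).trace +
       (tracePoly E q p.derivative).1 g * ∑ k, (g.1 * B.τ k).trace * (g.1 * B.τ k).trace) := by
    simp only [Jend_tracePoly_apply, r2, r3, Finset.mul_sum, ← Finset.sum_add_distrib]
    exact Finset.sum_congr rfl fun k _ => by ring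
  have hd : ∑ i, ∑ j, ∑ k, eps i j k *
        ((g.1 * B.τ i).trace * (Jend B j (Jbeg B k (tracePoly E q p))).1 g) =
      (tracePoly E q.derivative p).1 g * ∑ i, ∑ j, ∑ k, eps i j k *
        ((g.1 * B.τ i).trace * (B.τ j * g.1 * B.τ k * E).trace) +
      (tracePoly E q p.derivative).1 g * ∑ i, ∑ j, ∑ k, eps i j k *
        ((g.1 * B.τ i).trace * (B.τ j * g.1 * B.τ k).trace) +
      (tracePoly E q.derivative.derivative p).1 g * ∑ i, ∑ j, ∑ k, eps i j k *
        ((g.1 * B.τ i).trace * (g.1 * E * B.τ j).trace * (E * g.1 * B.τ k).trace) +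
      (tracePoly E q.derivative p.derivative).1 g * ∑ i, ∑ j, ∑ k, eps i j k *
        ((g.1 * B.τ i).trace * (g.1 * B.τ j).trace * (E * g.1 * B.τ k).trace) +
      (tracePoly E q.derivative p.derivative).1 g * ∑ i, ∑ j, ∑ k, eps i j k *
        ((g.1 * B.τ i).trace * (g.1 * E * B.τ j).trace * (g.1 * B.τ k).trace) +
      (tracePoly E q p.derivative.derivative).1 g * ∑ i, ∑ j, ∑ k, eps i j k *
        ((g.1 * B.τ i).trace * (g.1 * B.τ j).trace * (g.1 * B.τ k).trace) := by
    simp only [Finset.mul_sum, ← Finset.sum_add_distrib]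
    refine Finset.sum_congr rfl fun i _ => Finset.sum_congr rfl fun j _ =>
      Finset.sum_congr rfl fun k _ => ?_
    rw [Jend_Jbeg_tracePoly_apply, r1', r2, r3, Matrix.mul_assoc _ (B.τ k) E]
    ring
  rw [HE_one_apply, hb, hc, hd, s1, s2, s3, s4, s5, s6, s7, s8, s9]
  linear_combination ((tracePoly E q.derivative p).1 g * (-g.1.trace * (g.1 * E).trace) +
    (tracePoly E q p.derivative).1 g * (4 - g.1.trace ^ 2)) * Complex.I_sq

/-! ### Chebyshev polynomials and the Euclidean operator -/

namespace Polynomial.Chebyshev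

/-- `(X² - 4) S'ₙ` in terms of the neighbours of `Sₙ`. -/
theorem X_sq_sub_four_mul_derivative_S (n : ℕ) :
    (X ^ 2 - 4) * derivative (S ℂ n) =
      (n : ℂ[X]) * S ℂ (n + 1) - ((n : ℂ[X]) + 2) * S ℂ (n - 1) := by
  induction n using Nat.twoStepInduction with
  | zero => simp
  | one =>
    simp [S_two]
    ring
  | more n ih1 ih2 =>
    have h2 := S_add_two ℂ n
    have h3 := S_add_two ℂ (n + 1)
    have h1 := S_sub_one ℂ n
    push_cast at ih1 ih2 ⊢
    rw [show ((n : ℤ) + 1 + 1) = n + 2 by ring, show ((n : ℤ) + 1 - 1) = n by ring] at ih2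
    rw [show ((n : ℤ) + 1 + 2) = n + 3 by ring, show ((n : ℤ) + 1 + 1) = n + 2 by ring] at h3
    rw [show ((n : ℤ) + 2 + 1) = n + 3 by ring, show ((n : ℤ) + 2 - 1) = n + 1 by ring]
    rw [h1] at ih1
    rw [h3]
    rw [h2] at ih2 ⊢
    simp only [derivative_sub, derivative_mul, derivative_X]
    linear_combination X * ih2 - ih1

theorem derivative_S_succ_sub (n : ℕ) (hn : n ≠ 0) :
    derivative (S ℂ (n + 1)) - derivative (S ℂ (n - 1)) = ((n : ℂ[X]) + 1) * S ℂ n := by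
  obtain ⟨m, rfl⟩ := Nat.exists_eq_succ_of_ne_zero hn
  have hX : (X ^ 2 - 4 : ℂ[X]) ≠ 0 := by
    intro h
    have := congrArg (eval 0) h
    simp at this
  refine mul_left_cancel₀ hX ?_
  have e1 := X_sq_sub_four_mul_derivative_S (m + 1 + 1)
  have e2 := X_sq_sub_four_mul_derivative_S m
  have h2 := S_add_two ℂ m
  have h3 := S_add_two ℂ (m + 1)
  have h1 := S_sub_one ℂ m
  push_cast at e1 e2 ⊢
  rw [show ((m : ℤ) + 1 + 2) = m + 3 by ring, show ((m : ℤ) + 1 + 1) = m + 2 by ring] at h3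
  rw [show ((m : ℤ) + 1 + 1 + 1) = m + 3 by ring, show ((m : ℤ) + 1 + 1) = m + 2 by ring,
    show ((m : ℤ) + 2 - 1) = m + 1 by ring] at e1
  rw [show ((m : ℤ) + 1 + 1) = m + 2 by ring, show ((m : ℤ) + 1 - 1) = m by ring]
  rw [h3, h2] at e1
  rw [h1] at e2
  rw [mul_sub, h2, e2, e1]
  ring

theorem X_mul_S (n : ℤ) : X * S ℂ n = S ℂ (n + 1) + S ℂ (n - 1) := by
  rw [S_add_one]; ring

/-- The Chebyshev differential equation. -/
theorem X_sq_sub_four_mul_derivative_derivative_S (n : ℕ) :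
    (X ^ 2 - 4) * derivative (derivative (S ℂ n)) + 3 * X * derivative (S ℂ n) =
      (n : ℂ[X]) * ((n : ℂ[X]) + 2) * S ℂ n := by
  rcases eq_or_ne n 0 with rfl | hn
  · simp
  have h1 := congrArg derivative (X_sq_sub_four_mul_derivative_S n)
  have h2 := derivative_S_succ_sub n hn
  have h3 := congrArg derivative (X_mul_S n)
  have h4 : derivative ((n : ℂ[X]) + 2) = 0 := by
    rw [show (n : ℂ[X]) + 2 = ((n + 2 : ℕ) : ℂ[X]) by push_cast; rfl, derivative_natCast]
  have h5 : derivative ((X : ℂ[X]) ^ 2 - 4) = 2 * X := by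
    rw [derivative_sub, derivative_ofNat]; simp; norm_num
  simp only [derivative_mul, derivative_sub, derivative_add, derivative_natCast, derivative_X,
    h4, h5] at h1 h3
  linear_combination h1 + h3 + (n + 1) * h2

/-- The coefficients of the Euclidean operator come from this identity for the `k`-th derivatives
of the Chebyshev polynomials. -/
theorem iterate_derivative_S_identity (n k : ℕ) (hn : n ≠ 0) :
    ((n : ℂ[X]) + 1) * (((k : ℂ[X]) ^ 2 + 2 * (k : ℂ[X]) + 3) * X * derivative^[k] (S ℂ n) +
        (X ^ 2 - 4) * derivative^[k + 1] (S ℂ n)) =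
      ((n : ℂ[X]) + 1 - (k : ℂ[X])) * ((n : ℂ[X]) + 3 + (k : ℂ[X]) * ((k : ℂ[X]) + 1)) *
          derivative^[k] (S ℂ (n + 1)) -
        ((n : ℂ[X]) + 1 + (k : ℂ[X])) * ((n : ℂ[X]) - 1 - (k : ℂ[X]) * ((k : ℂ[X]) + 1)) *
          derivative^[k] (S ℂ (n - 1)) := by
  -- the `k`-th derivatives of the three-term relations
  have h1 : derivative^[k] (X * S ℂ n) = X * derivative^[k] (S ℂ n) +
      (k : ℂ[X]) * derivative^[k - 1] (S ℂ n) := by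
    rw [mul_comm, iterate_derivative_mul_X, nsmul_eq_mul, mul_comm]
  rw [X_mul_S, iterate_map_add] at h1
  have h2 : (k : ℂ[X]) * (((n : ℂ[X]) + 1) * derivative^[k - 1] (S ℂ n)) =
      (k : ℂ[X]) * (derivative^[k] (S ℂ (n + 1)) - derivative^[k] (S ℂ (n - 1))) := by
    rcases k with _ | k
    · simp
    · have h := congrArg derivative^[k] (derivative_S_succ_sub n hn)
      rw [iterate_derivative_sub, ← Function.iterate_succ_apply, ← Function.iterate_succ_apply,
        show (n : ℂ[X]) + 1 = ((n + 1 : ℕ) : ℂ[X]) by push_cast; rfl,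
        iterate_derivative_natCast_mul] at h
      rw [h, Nat.add_sub_cancel]
      push_cast
      rfl
  have h3 : derivative^[k] ((X ^ 2 - 4) * derivative (S ℂ n)) =
      (X ^ 2 - 4) * derivative^[k + 1] (S ℂ n) + 2 * (k : ℂ[X]) * X * derivative^[k] (S ℂ n) +
        (k : ℂ[X]) * ((k : ℂ[X]) - 1) * derivative^[k - 1] (S ℂ n) := by
    rw [show (X ^ 2 - 4 : ℂ[X]) * derivative (S ℂ n) =
      derivative (S ℂ n) * X * X - ((4 : ℕ) : ℂ[X]) * derivative (S ℂ n) by push_cast; ring,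
      iterate_derivative_sub, iterate_derivative_natCast_mul, iterate_derivative_mul_X,
      iterate_derivative_mul_X, iterate_derivative_mul_X]
    rcases k with _ | _ | k
    · simp; ring
    · simp; ring
    · simp only [← Function.iterate_succ_apply, Nat.add_sub_cancel, Nat.succ_eq_add_one,
        show k + 1 + 1 - 1 = k + 1 from rfl, nsmul_eq_mul]
      push_cast
      ring
  rw [X_sq_sub_four_mul_derivative_S, iterate_derivative_sub, iterate_derivative_natCast_mul,
    show (n : ℂ[X]) + 2 = ((n + 2 : ℕ) : ℂ[X]) by push_cast; rfl,
    iterate_derivative_natCast_mul] at h3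
  push_cast at h3
  linear_combination (-(n + 1 : ℂ[X])) * h3 - (n + 1) * (k ^ 2 + 3) * h1 - (k ^ 2 + k + 2) * h2

theorem natDegree_S_le (n : ℕ) : (S ℂ n).natDegree ≤ n := by
  induction n using Nat.twoStepInduction with
  | zero => simp
  | one => simp
  | more n ih1 ih2 =>
    push_cast at ih2 ⊢
    rw [S_add_two]
    refine (natDegree_sub_le _ _).trans (max_le ?_ (ih1.trans (by omega)))
    refine natDegree_mul_le.trans ?_
    rw [natDegree_X]
    omega

end Polynomial.Chebyshev

/-- The smooth function `g ↦ tr(gE)ᵏ Sₙ⁽ᵏ⁾(tr g)`: up to a factor, the coefficient of `ξᵏ` in the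
character `Sₙ(tr(g(1 + ξE)))`. -/
noncomputable def weightState (E : Matrix (Fin 2) (Fin 2) ℂ) (n k : ℕ) : Cyl :=
  tracePoly E (X ^ k) (derivative^[k] (Chebyshev.S ℂ n))

theorem weightState_apply (E : Matrix (Fin 2) (Fin 2) ℂ) (n k : ℕ) (g : SU2) :
    (weightState E n k).1 g =
      (g.1 * E).trace ^ k * (derivative^[k] (Chebyshev.S ℂ n)).eval g.1.trace := by
  simp [weightState, tracePoly_apply]

theorem weightState_eq_zero (E : Matrix (Fin 2) (Fin 2) ℂ) {n k : ℕ} (h : n < k) :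
    weightState E n k = 0 := by
  ext g
  rw [weightState_apply, iterate_derivative_eq_zero ((Chebyshev.natDegree_S_le n).trans_lt h)]
  simp

/-- The Euclidean operator moves `n` to `n ± 1` in the functions `weightState E n k`. -/
theorem HE_one_weightState (B : SU2Basis) {E : Matrix (Fin 2) (Fin 2) ℂ} (hE : E.trace = 0)
    (hE' : E.det = 0) (n k : ℕ) (hn : n ≠ 0) :
    HE B 1 (weightState E n k) =
      ((n + 1 - k) * (n + 3 + k * (k + 1)) / (2 * (n + 1)) : ℂ) • weightState E (n + 1) k -
      ((n + 1 + k) * (n - 1 - k * (k + 1)) / (2 * (n + 1)) : ℂ) • weightState E (n - 1) k := by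
  ext g
  have h := congrArg (eval g.1.trace) (Chebyshev.iterate_derivative_S_identity n k hn)
  simp only [eval_sub, eval_add, eval_mul, eval_pow, eval_natCast, eval_X, eval_ofNat,
    eval_one] at h
  have hn1 : ((n - 1 : ℕ) : ℤ) = n - 1 := by
    rw [Nat.cast_sub (Nat.one_le_iff_ne_zero.2 hn)]; rfl
  have hne : (n : ℂ) + 1 ≠ 0 := by exact_mod_cast n.succ_ne_zero
  change (HE B 1 (weightState E n k)).1 g =
    _ * (weightState E (n + 1) k).1 g - _ * (weightState E (n - 1) k).1 g
  rw [weightState, HE_one_tracePoly_apply B hE hE', weightState_apply, weightState_apply]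
  simp only [tracePoly_apply, ← Function.iterate_succ_apply' derivative, hn1]
  push_cast
  -- the Euler operator `u d/du` on `uᵏ`
  have hu1 : ∀ u : ℂ, u * (derivative (X ^ k : ℂ[X])).eval u = k * u ^ k := by
    intro u
    rcases k with _ | k
    · simp
    · simp; ring
  have hu2 : ∀ u : ℂ, u ^ 2 * (derivative (derivative (X ^ k : ℂ[X]))).eval u =
      k * (k - 1) * u ^ k := by
    intro u
    rcases k with _ | _ | k
    · simp
    · simp
    · simp; ring
  have h1 := hu1 (g.1 * E).trace
  have h2 := hu2 (g.1 * E).trace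
  simp only [eval_pow, eval_X]
  generalize eval (g.1 * E).trace (derivative (X ^ k : ℂ[X])) = d1 at *
  generalize eval (g.1 * E).trace (derivative (derivative (X ^ k : ℂ[X]))) = d2 at *
  have hne' : 2 * ((n : ℂ) + 1) ≠ 0 := mul_ne_zero two_ne_zero hne
  have hα : ∀ z : ℂ, 2 * ((n : ℂ) + 1) * (z / (2 * (n + 1))) = z := fun z => mul_div_cancel₀ z hne'
  refine mul_left_cancel₀ hne' ?_
  rw [mul_sub, ← mul_assoc _ (_ / _), ← mul_assoc _ (_ / _), hα, hα]
  linear_combination (g.1 * E).trace ^ k * h +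
    (n + 1) * g.1.trace * (derivative^[k] (Chebyshev.S ℂ n)).eval g.1.trace * (3 * h1 + h2)

/-! ### Wigner matrices as symmetric powers -/

/-- The `n`-th symmetric power of a `2 × 2` matrix in the monomial basis `x^(n-a) y^a`, i.e. the
Wigner matrix without its normalising square roots. -/
noncomputable def symPow (n : ℕ) (g : Matrix (Fin 2) (Fin 2) ℂ) :
    Matrix (Fin (n + 1)) (Fin (n + 1)) ℂ :=
  of fun b a => ((C (g 0 0) + C (g 1 0) * X) ^ (n - a.1) *
    (C (g 0 1) + C (g 1 1) * X) ^ a.1 : ℂ[X]).coeff b.1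

/-- The norm `√((n-a)! a!)` of the monomial `x^(n-a) y^a`. -/
noncomputable def monomialNorm (n a : ℕ) : ℝ := √((n - a).factorial * a.factorial : ℝ)

theorem monomialNorm_pos (n a : ℕ) : 0 < monomialNorm n a :=
  Real.sqrt_pos.2 (by positivity)

theorem monomialNorm_ne_zero (n a : ℕ) : (monomialNorm n a : ℂ) ≠ 0 := by
  exact_mod_cast (monomialNorm_pos n a).ne'

theorem monomialNorm_sq (n a : ℕ) :
    (monomialNorm n a : ℂ) ^ 2 = (n - a).factorial * a.factorial := by
  have h : monomialNorm n a ^ 2 = (n - a).factorial * a.factorial :=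
    Real.sq_sqrt (by positivity)
  exact_mod_cast h

theorem wignerD_apply (n : ℕ) (g : Matrix (Fin 2) (Fin 2) ℂ) (b a : Fin (n + 1)) :
    wignerD n g b a = monomialNorm n b / monomialNorm n a * symPow n g b a := by
  simp only [wignerD, symPow, of_apply, monomialNorm]
  rw [Real.sqrt_div (by positivity)]
  push_cast
  rfl

theorem natDegree_linear_pow_le (a b : ℂ) (n : ℕ) :
    ((C a + C b * X : ℂ[X]) ^ n).natDegree ≤ n := by
  have h : (C a + C b * X : ℂ[X]).natDegree ≤ 1 := by
    rw [add_comm]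
    exact natDegree_linear_le
  exact (natDegree_pow_le_of_le n h).trans_eq (mul_one n)

theorem homogenize_linear_pow (a b : ℂ) (n : ℕ) :
    homogenize ((C a + C b * X : ℂ[X]) ^ n) n =
      (MvPolynomial.C a * MvPolynomial.X 1 + MvPolynomial.C b * MvPolynomial.X 0) ^ n := by
  induction n with
  | zero => simp
  | succ n ih =>
    rw [pow_succ, homogenize_mul _ _ (natDegree_linear_pow_le a b n)
      (by simpa using natDegree_linear_pow_le a b 1), ih, pow_succ]
    simp

/-- Substituting polynomials in a homogenised product of powers of two linear forms. -/
theorem sum_coeff_linear_pow_mul (a b c d : ℂ) {l m n : ℕ} (h : l + m = n) (p q : ℂ[X]) :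
    ∑ i ∈ Finset.range (n + 1),
        C (((C a + C b * X) ^ l * (C c + C d * X) ^ m : ℂ[X]).coeff i) * (p ^ (n - i) * q ^ i) =
      (C a * p + C b * q) ^ l * (C c * p + C d * q) ^ m := by
  subst h
  have h1 := congrArg (MvPolynomial.aeval ![q, p])
    (homogenize_mul _ _ (natDegree_linear_pow_le a b l) (natDegree_linear_pow_le c d m))
  rw [homogenize_linear_pow, homogenize_linear_pow, homogenize, map_sum,
    Finset.Nat.sum_antidiagonal_eq_sum_range_succ_mk] at h1
  simp only [map_mul, map_pow, map_add, MvPolynomial.aeval_X, MvPolynomial.aeval_C,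
    cons_val_zero, cons_val_one] at h1
  simp only [← C_eq_algebraMap] at h1
  rw [← h1]
  refine Finset.sum_congr rfl fun i _ => ?_
  rw [MvPolynomial.aeval_monomial, ← C_eq_algebraMap, Finsupp.prod_fintype _ _ (by simp)]
  simp only [Fin.prod_univ_two]
  rw [mul_comm (p ^ _)]
  simp

theorem symPow_mul (n : ℕ) (g h : Matrix (Fin 2) (Fin 2) ℂ) :
    symPow n (g * h) = symPow n g * symPow n h := by
  ext b a
  simp only [symPow, of_apply, Matrix.mul_apply]
  have ha : n - a.1 + a.1 = n := Nat.sub_add_cancel (Nat.lt_succ_iff.1 a.2)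
  have h1 := sum_coeff_linear_pow_mul (h 0 0) (h 1 0) (h 0 1) (h 1 1) ha
    (C (g 0 0) + C (g 1 0) * X) (C (g 0 1) + C (g 1 1) * X)
  have h2 := congrArg (fun r => coeff r b.1) h1
  simp only [finsetSum_coeff, coeff_C_mul] at h2
  rw [Finset.sum_range] at h2
  simp only [Fin.sum_univ_two, map_add, map_mul]
  convert h2.symm using 1
  · congr 2 <;> ring
  · exact Finset.sum_congr rfl fun c _ => mul_comm _ _

theorem symPow_one (n : ℕ) : symPow n 1 = 1 := by
  ext b a
  simp [symPow, one_apply, coeff_X_pow, Fin.ext_iff]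

theorem wignerD_mul (n : ℕ) (g h : Matrix (Fin 2) (Fin 2) ℂ) :
    wignerD n (g * h) = wignerD n g * wignerD n h := by
  ext b a
  simp only [Matrix.mul_apply, wignerD_apply, symPow_mul, Finset.mul_sum]
  refine Finset.sum_congr rfl fun c _ => ?_
  have := monomialNorm_ne_zero n c
  have := monomialNorm_ne_zero n a
  field_simp

theorem trace_wignerD (n : ℕ) (g : Matrix (Fin 2) (Fin 2) ℂ) :
    (wignerD n g).trace = (symPow n g).trace := by
  refine Finset.sum_congr rfl fun a _ => ?_
  rw [diag_apply, wignerD_apply, div_self (monomialNorm_ne_zero n a), one_mul]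
  rfl

theorem trace_symPow_of_upper (n : ℕ) {T : Matrix (Fin 2) (Fin 2) ℂ} (h : T 1 0 = 0) :
    (symPow n T).trace = ∑ a ∈ Finset.range (n + 1), T 0 0 ^ (n - a) * T 1 1 ^ a := by
  rw [Finset.sum_range]
  refine Finset.sum_congr rfl fun a _ => ?_
  have hc : ((C (T 0 1) + C (T 1 1) * X : ℂ[X]) ^ a.1).coeff a.1 = T 1 1 ^ a.1 := by
    have h1 := coeff_pow_of_natDegree_le (p := (C (T 0 1) + C (T 1 1) * X : ℂ[X])) (m := a.1)
      (n := 1) (by rw [add_comm]; exact natDegree_linear_le)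
    rw [mul_one] at h1
    rw [h1]
    simp [coeff_C]
  rw [diag_apply, symPow, of_apply, h, C_0, zero_mul, add_zero, ← C_pow, coeff_C_mul, hc]

theorem sum_pow_mul_pow_eq_eval_S (n : ℕ) {x y : ℂ} (h : x * y = 1) :
    ∑ a ∈ Finset.range (n + 1), x ^ (n - a) * y ^ a = (Chebyshev.S ℂ n).eval (x + y) := by
  have hs : ∀ n : ℕ, ∑ a ∈ Finset.range (n + 2), x ^ (n + 1 - a) * y ^ a =
      x * (∑ a ∈ Finset.range (n + 1), x ^ (n - a) * y ^ a) + y ^ (n + 1) := by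
    intro n
    rw [Finset.sum_range_succ, Nat.sub_self, pow_zero, one_mul, Finset.mul_sum]
    congr 1
    refine Finset.sum_congr rfl fun a ha => ?_
    rw [Nat.succ_sub (Nat.lt_succ_iff.1 (Finset.mem_range.1 ha)), pow_succ]
    ring
  induction n using Nat.twoStepInduction with
  | zero => simp
  | one => simp [Finset.sum_range_succ]
  | more n ih1 ih2 =>
    rw [hs] at ih2
    rw [hs, hs]
    push_cast at ih2 ⊢
    rw [Chebyshev.S_add_two, eval_sub, eval_mul, eval_X, ← ih1, ← ih2]
    linear_combination (-(∑ a ∈ Finset.range (n + 1), x ^ (n - a) * y ^ a)) * h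

/-- Every complex `2 × 2` matrix is conjugate to an upper triangular one. -/
theorem exists_triangularization (M : Matrix (Fin 2) (Fin 2) ℂ) :
    ∃ P Q T : Matrix (Fin 2) (Fin 2) ℂ, M = P * T * Q ∧ Q * P = 1 ∧ T 1 0 = 0 := by
  by_cases h : M 1 0 = 0
  · exact ⟨1, 1, M, by simp, by simp, h⟩
  · obtain ⟨z, hz⟩ := IsAlgClosed.exists_root
      (X ^ 2 - C M.trace * X + C M.det : ℂ[X]) (by
        rw [show (X ^ 2 - C M.trace * X + C M.det : ℂ[X]) =
          C 1 * X ^ 2 + C (-M.trace) * X + C M.det by simp [sub_eq_add_neg],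
          degree_quadratic one_ne_zero]
        norm_num)
    simp only [IsRoot, eval_add, eval_sub, eval_pow, eval_mul, eval_X, eval_C, trace_fin_two,
      det_fin_two] at hz
    -- the first column of `P` is an eigenvector
    set P : Matrix (Fin 2) (Fin 2) ℂ := !![z - M 1 1, -(M 1 0)⁻¹; M 1 0, 0]
    set Q : Matrix (Fin 2) (Fin 2) ℂ := !![0, (M 1 0)⁻¹; -M 1 0, z - M 1 1]
    have hQP : Q * P = 1 := by
      ext a b
      fin_cases a <;> fin_cases b <;> (simp [P, Q, h]; try ring)
    have hPQ : P * Q = 1 := mul_eq_one_comm.1 hQP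
    refine ⟨P, Q, Q * M * P, ?_, hQP, ?_⟩
    · simp only [← Matrix.mul_assoc, hPQ, Matrix.one_mul]
      rw [Matrix.mul_assoc, hPQ, Matrix.mul_one]
    · simp only [P, Q, Matrix.mul_apply, Fin.sum_univ_two]
      simp
      linear_combination M 1 0 * hz

/-- The characters of `SL(2, ℂ)` are Chebyshev polynomials in the trace. -/
theorem trace_wignerD_eq_eval_S (n : ℕ) {M : Matrix (Fin 2) (Fin 2) ℂ} (hM : M.det = 1) :
    (wignerD n M).trace = (Chebyshev.S ℂ n).eval M.trace := by
  obtain ⟨P, Q, T, rfl, hQP, hT⟩ := exists_triangularization M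
  have h1 : (symPow n (P * T * Q)).trace = (symPow n T).trace := by
    rw [symPow_mul, symPow_mul, trace_mul_comm, ← Matrix.mul_assoc, ← symPow_mul, hQP, symPow_one,
      Matrix.one_mul]
  have h2 : (P * T * Q).trace = T 0 0 + T 1 1 := by
    rw [trace_mul_comm, ← Matrix.mul_assoc, hQP, Matrix.one_mul, trace_fin_two]
  have h3 : T 0 0 * T 1 1 = 1 := by
    have hdet : T.det = 1 := by
      rw [← hM, det_mul, det_mul, mul_comm, ← mul_assoc, ← det_mul, hQP, det_one, one_mul]
    rw [det_fin_two, hT, mul_zero, sub_zero] at hdet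
    exact hdet
  rw [trace_wignerD, h1, h2, trace_symPow_of_upper n hT, sum_pow_mul_pow_eq_eval_S n h3]

/-! ### Generating functions of symmetric powers -/

/-- A one-parameter family of nilpotent matrices that spans `sl(2, ℂ)`: the entries of symmetric
powers of `1 + ξ E(x)` are generating functions, in `ξ` and `x`, of the `3j`-symbols. -/
def nilpotentMatrix (x : ℂ) : Matrix (Fin 2) (Fin 2) ℂ := !![-x, 1; -x ^ 2, x]

theorem trace_nilpotentMatrix (x : ℂ) : (nilpotentMatrix x).trace = 0 := by
  simp [nilpotentMatrix, trace_fin_two]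

theorem det_nilpotentMatrix (x : ℂ) : (nilpotentMatrix x).det = 0 := by
  simp [nilpotentMatrix, det_fin_two]; ring

theorem det_one_add_smul_nilpotentMatrix (x ξ : ℂ) : (1 + ξ • nilpotentMatrix x).det = 1 := by
  simp [nilpotentMatrix, det_fin_two]; ring

theorem coeff_linear_pow {R : Type*} [CommRing R] (p q : R) (n b : ℕ) :
    ((C p + C q * X : R[X]) ^ n).coeff b = n.choose b * (p ^ (n - b) * q ^ b) := by
  have h : (C p + C q * X : R[X]) ^ n =
      ∑ m ∈ Finset.range (n + 1), C (n.choose m * (p ^ (n - m) * q ^ m)) * X ^ m := by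
    rw [add_comm, add_pow]
    refine Finset.sum_congr rfl fun m _ => ?_
    simp only [mul_pow, map_mul, map_pow, map_natCast]
    ring
  simp only [h, finsetSum_coeff, coeff_C_mul_X_pow]
  rw [Finset.sum_ite_eq]
  split_ifs with hb
  · rfl
  · rw [Nat.choose_eq_zero_of_lt (by simpa using hb)]
    simp

/-- The alternating sum of products of three binomial coefficients in Racah's formula for the
`3j`-symbol with legs `n/2, k, n/2`, up to a sign; the summation index is `i = k - t` in terms of
the usual one. -/
def racahSum (n k a b : ℕ) : ℂ :=
  ∑ i ∈ Finset.range (k + 1), if i ≤ a ∧ a ≤ b + i then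
    (-1) ^ (k + a + b + i) * (k.choose i * (n - k).choose (a - i) * k.choose (b + i - a)) else 0

theorem racahSum_eq_zero_of_lt {n k a b : ℕ} (h : k + a < b ∨ b + k < a) :
    racahSum n k a b = 0 := by
  refine Finset.sum_eq_zero fun i hi => ?_
  rw [Finset.mem_range] at hi
  split_ifs with h'
  · rw [Nat.choose_eq_zero_of_lt (show k < b + i - a by omega)]
    simp
  · rfl

/-- The generating function of `racahSum`. -/
theorem coeff_coeff_eq_racahSum (m k a b : ℕ) (x : ℂ) :
    (((1 + C X * X) ^ m * (C (1 + C x * X) * (X - C (C x))) ^ k : ℂ[X][X]).coeff b).coeff a =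
      x ^ (k + a - b) * racahSum (m + k) k a b := by
  have h1 : ∀ e, (((1 + C X * X) ^ m * (X - C (C x)) ^ k : ℂ[X][X]).coeff b).coeff e =
      if e ≤ b then (m.choose e : ℂ) * (k.choose (b - e) * (-x) ^ (k - (b - e))) else 0 := by
    intro e
    have e1 : (1 + C X * X : ℂ[X][X]) = C 1 + C X * X := by simp
    have e2 : (X - C (C x) : ℂ[X][X]) = C (C (-x)) + C 1 * X := by
      rw [C_neg, C_neg, C_1, one_mul]; ring
    rw [e1, e2, coeff_mul, Finset.Nat.sum_antidiagonal_eq_sum_range_succ_mk, finsetSum_coeff]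
    simp only [coeff_linear_pow]
    have e3 : ∀ d, ((m.choose d : ℂ[X]) * (1 ^ (m - d) * X ^ d) *
        ((k.choose (b - d) : ℂ[X]) * (C (-x) ^ (k - (b - d)) * 1 ^ (b - d)))).coeff e =
        if e = d then (m.choose d : ℂ) * (k.choose (b - d) * (-x) ^ (k - (b - d))) else 0 := by
      intro d
      rw [show (m.choose d : ℂ[X]) * (1 ^ (m - d) * X ^ d) *
        ((k.choose (b - d) : ℂ[X]) * (C (-x) ^ (k - (b - d)) * 1 ^ (b - d))) =
        C (m.choose d * (k.choose (b - d) * (-x) ^ (k - (b - d)))) * X ^ d by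
          simp only [map_mul, map_pow, map_natCast, one_pow]; ring, coeff_C_mul_X_pow]
    simp only [e3]
    rw [Finset.sum_ite_eq]
    simp
  have h2 : ((1 + C X * X) ^ m * (C (1 + C x * X) * (X - C (C x))) ^ k : ℂ[X][X]) =
      C ((C 1 + C x * X) ^ k) * ((1 + C X * X) ^ m * (X - C (C x)) ^ k) := by
    rw [mul_pow, C_pow, C_1]; ring
  rw [h2, coeff_C_mul, coeff_mul, Finset.Nat.sum_antidiagonal_eq_sum_range_succ_mk, racahSum,
    Finset.mul_sum]
  simp only [h1, coeff_linear_pow, Nat.add_sub_cancel]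
  -- both sums run over `i ≤ min k a`
  have h3 : ∀ i, i ≤ a → (k.choose i : ℂ) * (1 ^ (k - i) * x ^ i) * (if a - i ≤ b then
      (m.choose (a - i) : ℂ) * ((k.choose (b - (a - i)) : ℂ) * (-x) ^ (k - (b - (a - i)))) else 0) =
      x ^ (k + a - b) * (if i ≤ a ∧ a ≤ b + i then (-1) ^ (k + a + b + i) *
        ((k.choose i : ℂ) * (m.choose (a - i) : ℂ) * (k.choose (b + i - a) : ℂ)) else 0) := by
    intro i hi
    by_cases hab : a ≤ b + i
    · rw [if_pos (show a - i ≤ b by omega), if_pos ⟨hi, hab⟩,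
        show b - (a - i) = b + i - a by omega]
      by_cases hk : b + i - a ≤ k
      · rw [neg_pow, show k + a - b = i + (k - (b + i - a)) by omega, pow_add,
          show k + a + b + i = (k - (b + i - a)) + 2 * (b + i) by omega, pow_add (-1 : ℂ),
          pow_mul (-1 : ℂ) 2]
        simp only [even_two, Even.neg_pow, one_pow, mul_one, one_mul]
        ring
      · rw [Nat.choose_eq_zero_of_lt (not_le.1 hk)]
        simp
    · rw [if_neg (show ¬ a - i ≤ b by omega), if_neg (fun h => hab h.2)]
      simp
  rw [Finset.sum_congr rfl fun i hi => h3 i (Nat.lt_succ_iff.1 (Finset.mem_range.1 hi))]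
  rcases le_total a k with h | h
  · refine Finset.sum_subset (Finset.range_mono (by omega)) fun i _ hi => ?_
    rw [if_neg (fun h' => hi (Finset.mem_range.2 (by omega))), mul_zero]
  · refine (Finset.sum_subset (Finset.range_mono (by omega)) fun i _ hi => ?_).symm
    rw [Nat.choose_eq_zero_of_lt (show k < i by simpa using hi)]
    simp

/-- The entries of the symmetric powers of `1 + ξ E(x)`. For any matrix `M`, the numbers
`(n choose b) (symPow n M)ₐᵦ` are the coefficients of `XᵃYᵇ` in
`(M₀₀ + M₁₀ X + M₀₁ Y + M₁₁ XY)ⁿ`; here the base is `1 + XY + ξ (1 + xX)(Y - x)`. -/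
theorem choose_mul_symPow_nilpotent (n : ℕ) (x ξ : ℂ) (a b : Fin (n + 1)) :
    n.choose b * symPow n (1 + ξ • nilpotentMatrix x) a b =
      ∑ k ∈ Finset.range (n + 1),
        ξ ^ k * (n.choose k * (x ^ (k + a.1 - b.1) * racahSum n k a b)) := by
  set M := 1 + ξ • nilpotentMatrix x with hM
  have h1 : (C (C (M 0 0) + C (M 1 0) * X) + C (C (M 0 1) + C (M 1 1) * X) * X : ℂ[X][X]) =
      C (C ξ) * (C (1 + C x * X) * (X - C (C x))) + (1 + C X * X) := by
    have m00 : M 0 0 = 1 - ξ * x := by simp [hM, nilpotentMatrix]; ring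
    have m01 : M 0 1 = ξ := by simp [hM, nilpotentMatrix]
    have m10 : M 1 0 = -(ξ * x ^ 2) := by simp [hM, nilpotentMatrix]
    have m11 : M 1 1 = 1 + ξ * x := by simp [hM, nilpotentMatrix]
    rw [m00, m01, m10, m11]
    simp only [map_add, map_mul, map_sub, map_neg, map_pow, map_one]
    ring
  have h2 := coeff_linear_pow (C (M 0 0) + C (M 1 0) * X) (C (M 0 1) + C (M 1 1) * X) n b
  rw [h1, add_pow, finsetSum_coeff] at h2
  have h3 := congrArg (fun p => coeff p a.1) h2
  simp only [finsetSum_coeff] at h3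
  rw [← C_eq_natCast, coeff_C_mul] at h3
  rw [symPow, of_apply, ← h3]
  refine Finset.sum_congr rfl fun k hk => ?_
  have hk' : n - k + k = n := Nat.sub_add_cancel (Nat.lt_succ_iff.1 (Finset.mem_range.1 hk))
  have h4 := coeff_coeff_eq_racahSum (n - k) k a b x
  rw [hk'] at h4
  rw [← h4, show (C (C ξ) * (C (1 + C x * X) * (X - C (C x)))) ^ k * (1 + C X * X) ^ (n - k) *
    (n.choose k : ℂ[X][X]) = C (C (ξ ^ k * n.choose k)) * ((1 + C X * X) ^ (n - k) *
      (C (1 + C x * X) * (X - C (C x))) ^ k) by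
        rw [mul_pow]
        simp only [map_mul, map_pow, map_natCast]
        ring, coeff_C_mul, coeff_C_mul]
  ring

/-! ### The `3j`-symbols and the gauge-variant states -/

/-- The coefficient of `ξᵏ` in the Wigner matrix of `1 + ξ E(x)`. -/
noncomputable def nilpotentComponent (n k : ℕ) (x : ℂ) :
    Matrix (Fin (n + 1)) (Fin (n + 1)) ℂ :=
  of fun a b => monomialNorm n a / monomialNorm n b *
    (n.choose k / n.choose b.1 * (x ^ (k + a.1 - b.1) * racahSum n k a b))

theorem wignerD_one_add_smul_nilpotentMatrix (n : ℕ) (x ξ : ℂ) :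
    wignerD n (1 + ξ • nilpotentMatrix x) =
      ∑ k ∈ Finset.range (n + 1), ξ ^ k • nilpotentComponent n k x := by
  ext a b
  have hb : (n.choose b.1 : ℂ) ≠ 0 := by
    exact_mod_cast (Nat.choose_pos (Nat.lt_succ_iff.1 b.2)).ne'
  rw [wignerD_apply, Matrix.sum_apply]
  have h := choose_mul_symPow_nilpotent n x ξ a b
  rw [mul_comm, ← eq_div_iff hb] at h
  rw [h, Finset.sum_div, Finset.mul_sum]
  refine Finset.sum_congr rfl fun k _ => ?_
  rw [Matrix.smul_apply, nilpotentComponent, of_apply, smul_eq_mul]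
  field_simp

/-- The character of `g (1 + ξ E(x))`, expanded in powers of `ξ`. -/
theorem trace_wignerD_mul_nilpotentComponent {n k : ℕ} (hk : k ≤ n) (x : ℂ) (g : SU2) :
    (wignerD n g.1 * nilpotentComponent n k x).trace =
      (g.1 * nilpotentMatrix x).trace ^ k *
        (hasseDeriv k (Chebyshev.S ℂ n)).eval g.1.trace := by
  set u := (g.1 * nilpotentMatrix x).trace with hu
  have h : ∑ k ∈ Finset.range (n + 1),
      C (wignerD n g.1 * nilpotentComponent n k x).trace * X ^ k =
      (taylor g.1.trace (Chebyshev.S ℂ n)).comp (C u * X) := by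
    refine Polynomial.funext fun ξ => ?_
    have h1 : (wignerD n (g.1 * (1 + ξ • nilpotentMatrix x))).trace =
        (Chebyshev.S ℂ n).eval (ξ * u + g.1.trace) := by
      rw [trace_wignerD_eq_eval_S, Matrix.mul_add, Matrix.mul_one, trace_add, Matrix.mul_smul,
        trace_smul, smul_eq_mul, add_comm]
      rw [det_mul, (mem_specialUnitaryGroup_iff.1 g.2).2, det_one_add_smul_nilpotentMatrix,
        one_mul]
    rw [wignerD_mul, wignerD_one_add_smul_nilpotentMatrix, Finset.mul_sum, trace_sum] at h1
    rw [eval_comp, taylor_eval, eval_mul, eval_C, eval_X, mul_comm u, ← h1, eval_finsetSum]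
    refine Finset.sum_congr rfl fun k _ => ?_
    rw [Matrix.mul_smul, trace_smul, eval_mul, eval_C, eval_pow, eval_X, smul_eq_mul, mul_comm]
  have h2 := congrArg (fun p => coeff p k) h
  simp only [finsetSum_coeff, coeff_C_mul_X_pow, comp_C_mul_X_coeff, taylor_coeff] at h2
  rw [Finset.sum_ite_eq, if_pos (Finset.mem_range.2 (Nat.lt_succ_of_le hk))] at h2
  rw [h2, mul_comm]

/-- The factor of the `3j`-symbol `(n/2 k n/2)` that depends on `n` and `k` only. -/
noncomputable def threeJNorm (n k : ℕ) : ℝ :=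
  √(1 / ((n + k + 1).factorial * k.factorial * (n - k).factorial * k.factorial))

/-- Racah's formula for the intertwiner, in terms of `racahSum`. -/
theorem intertwiner_apply {n k c : ℕ} (hk : k ≤ n) (hc : c ≤ 2 * k) (a b : Fin (n + 1)) :
    intertwiner n k c a b = if c + b.1 = k + a.1 then
      (-1) ^ k * (monomialNorm n a * monomialNorm n b * monomialNorm (2 * k) c *
        threeJNorm n k) * racahSum n k a b else 0 := by
  have ha : a.1 ≤ n := Nat.lt_succ_iff.1 a.2
  have hb : b.1 ≤ n := Nat.lt_succ_iff.1 b.2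
  rw [intertwiner, of_apply, threeJ]
  by_cases h : c + b.1 = k + a.1
  swap
  · rw [if_neg h, if_neg (by omega)]
    simp
  rw [if_pos h, if_pos (by omega)]
  have e1 : (n + 2 * k - n) / 2 = k := by omega
  have e2 : (n + n - 2 * k) / 2 = n - k := by omega
  have e3 : (2 * k + n - n) / 2 = k := by omega
  have e4 : (n + 2 * k + n) / 2 = n + k := by omega
  have e5 : n - (n - a.1) = a.1 := by omega
  rw [e1, e2, e3, e4, e5]
  have hs : √(((n - a.1).factorial * a.1.factorial * c.factorial * (2 * k - c).factorial *
      b.1.factorial * (n - b.1).factorial : ℝ) /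
        ((n + k + 1).factorial * k.factorial * (n - k).factorial * k.factorial)) =
      monomialNorm n a * monomialNorm n b * monomialNorm (2 * k) c * threeJNorm n k := by
    rw [monomialNorm, monomialNorm, monomialNorm, threeJNorm, ← Real.sqrt_mul (by positivity),
      ← Real.sqrt_mul (by positivity), ← Real.sqrt_mul (by positivity)]
    congr 1
    ring
  rw [hs]
  -- the cast of the sum in `threeJ` is `racahSum` up to a sign
  have hr : ((∑ t ∈ Finset.range (k + 1), (if t ≤ n - a.1 ∧ t ≤ 2 * k - c then
      (-1) ^ t * (k.choose t : ℝ) * (n - k).choose (n - a.1 - t) * k.choose (2 * k - c - t)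
      else 0) : ℝ) : ℂ) = (-1) ^ (a.1 + b.1) * racahSum n k a b := by
    -- Racah's summation index is `k - i`
    rw [← Finset.sum_range_reflect, racahSum, Finset.mul_sum]
    push_cast
    refine Finset.sum_congr rfl fun i hi => ?_
    have hi' : i ≤ k := Nat.lt_succ_iff.1 (Finset.mem_range.1 hi)
    have hsign : ((-1 : ℂ)) ^ (k - i) = (-1) ^ (a.1 + b.1) * (-1) ^ (k + a.1 + b.1 + i) := by
      rw [← pow_add, show a.1 + b.1 + (k + a.1 + b.1 + i) = (k - i) + 2 * (a.1 + b.1 + i) by omega,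
        pow_add, pow_mul]
      simp
    by_cases h1 : i ≤ a.1 ∧ a.1 ≤ b.1 + i
    · rw [if_pos h1]
      by_cases h2 : k - i ≤ n - a.1
      · rw [if_pos (by omega)]
        push_cast
        rw [hsign, Nat.choose_symm hi',
          ← Nat.choose_symm (show a.1 - i ≤ n - k by omega),
          show n - k - (a.1 - i) = n - a.1 - (k - i) by omega,
          show 2 * k - c - (k - i) = b.1 + i - a.1 by omega]
        ring
      · rw [if_neg (by omega), Nat.choose_eq_zero_of_lt (show n - k < a.1 - i by omega)]
        simp
    · rw [if_neg h1, mul_zero]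
      split_ifs with h2
      · rw [Nat.choose_eq_zero_of_lt (show n - k < n - a.1 - (k - i) by omega)]
        simp
      · rfl
  rw [Complex.ofReal_mul, Complex.ofReal_mul, hr]
  have hsign : ((-1 : ℂ)) ^ a.1 * (-1) ^ (b.1 + k) * (-1) ^ (a.1 + b.1) = (-1) ^ k := by
    rw [← pow_add, ← pow_add, show a.1 + (b.1 + k) + (a.1 + b.1) = 2 * (a.1 + b.1) + k by omega,
      pow_add, pow_mul]
    simp
  push_cast
  linear_combination (monomialNorm n a * monomialNorm n b * monomialNorm (2 * k) c *
        threeJNorm n k * racahSum n k a b) * hsign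

/-- The generating function, in the magnetic number of the free leg, of the intertwiners. -/
theorem sum_smul_intertwiner {n k : ℕ} (hk : k ≤ n) (x : ℂ) :
    ∑ c ∈ Finset.range (2 * k + 1), (x ^ c / monomialNorm (2 * k) c) • intertwiner n k c =
      ((-1) ^ k * threeJNorm n k * k.factorial * (n - k).factorial : ℂ) •
        nilpotentComponent n k x := by
  ext a b
  have hb : b.1 ≤ n := Nat.lt_succ_iff.1 b.2
  rw [Matrix.sum_apply, Matrix.smul_apply, nilpotentComponent, of_apply, smul_eq_mul]
  have h1 : ∀ c ∈ Finset.range (2 * k + 1),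
      ((x ^ c / monomialNorm (2 * k) c) • intertwiner n k c) a b =
      if c + b.1 = k + a.1 then (-1) ^ k * (monomialNorm n a * monomialNorm n b * threeJNorm n k) *
        (x ^ (k + a.1 - b.1) * racahSum n k a b) else 0 := by
    intro c hc
    rw [Matrix.smul_apply, intertwiner_apply hk (Nat.lt_succ_iff.1 (Finset.mem_range.1 hc)),
      smul_eq_mul]
    split_ifs with h
    · have := monomialNorm_ne_zero (2 * k) c
      rw [show k + a.1 - b.1 = c by omega]
      field_simp
    · simp
  rw [Finset.sum_congr rfl h1]
  have hch : (monomialNorm n b : ℂ) ^ 2 * n.choose b.1 = n.choose k * k.factorial *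
      (n - k).factorial := by
    rw [monomialNorm_sq]
    have e1 := Nat.choose_mul_factorial_mul_factorial hb
    have e2 := Nat.choose_mul_factorial_mul_factorial hk
    exact_mod_cast show (n - b.1).factorial * b.1.factorial * n.choose b.1 =
      n.choose k * k.factorial * (n - k).factorial by rw [e2, ← e1]; ring
  have hb' : (n.choose b.1 : ℂ) ≠ 0 := by exact_mod_cast (Nat.choose_pos hb).ne'
  have hw := monomialNorm_ne_zero n b
  by_cases h : b.1 ≤ k + a.1 ∧ a.1 ≤ b.1 + k
  · rw [Finset.sum_eq_single (k + a.1 - b.1), if_pos (by omega)]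
    · field_simp
      linear_combination (monomialNorm n a * threeJNorm n k * x ^ (k + a.1 - b.1) *
        racahSum n k a b) * hch
    · intro c _ hc
      rw [if_neg (by omega)]
    · intro hc
      exact absurd (Finset.mem_range.2 (by omega)) hc
  · rw [racahSum_eq_zero_of_lt (by omega)]
    simp

theorem ketGV'_eq_zero {n k c : ℕ} (h : n < k) : ketGV' n k c = 0 := by
  ext g
  change (wignerD n g.1 * intertwiner n k c).trace = 0
  have h0 : intertwiner n k c = 0 := by
    ext a b
    rw [intertwiner, of_apply, threeJ, if_neg (by omega)]
    simp
  rw [h0, Matrix.mul_zero, trace_zero]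

theorem ketGV'_apply (n k c : ℕ) (g : SU2) :
    (ketGV' n k c).1 g = (wignerD n g.1 * intertwiner n k c).trace := rfl

/-- The factor between the gauge-variant states and the functions `tr(gE)ᵏ Sₙ⁽ᵏ⁾(tr g)`. -/
noncomputable def ketNorm (n k : ℕ) : ℂ := (-1) ^ k * threeJNorm n k * (n - k).factorial

/-- The gauge-variant states are the coefficients, in `x`, of `tr(gE(x))ᵏ Sₙ⁽ᵏ⁾(tr g)`. -/
theorem sum_smul_ketGV' (n k : ℕ) (x : ℂ) :
    ∑ c ∈ Finset.range (2 * k + 1), (x ^ c / monomialNorm (2 * k) c : ℂ) • ketGV' n k c =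
      ketNorm n k • weightState (nilpotentMatrix x) n k := by
  rcases lt_or_ge n k with h | hk
  · rw [weightState_eq_zero _ h, smul_zero]
    exact Finset.sum_eq_zero fun c _ => by rw [ketGV'_eq_zero h, smul_zero]
  ext g
  have h1 := congrArg (fun T => (wignerD n g.1 * T).trace) (sum_smul_intertwiner hk x)
  simp only [Finset.mul_sum, trace_sum, Matrix.mul_smul, trace_smul, smul_eq_mul,
    trace_wignerD_mul_nilpotentComponent hk] at h1
  have h2 : (derivative^[k] (Chebyshev.S ℂ n)) =
      k.factorial • hasseDeriv k (Chebyshev.S ℂ n) := by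
    rw [← factorial_smul_hasseDeriv]; rfl
  have h3 : ∀ s : Finset ℕ, (∑ c ∈ s, (x ^ c / monomialNorm (2 * k) c : ℂ) • ketGV' n k c).1 g =
      ∑ c ∈ s, x ^ c / monomialNorm (2 * k) c * (wignerD n g.1 * intertwiner n k c).trace := by
    intro s
    simp [Finset.sum_apply, ketGV'_apply]
  rw [h3, h1]
  change _ = ketNorm n k * (weightState (nilpotentMatrix x) n k).1 g
  rw [weightState_apply, h2, eval_smul, nsmul_eq_mul, ketNorm]
  ring

/-! ### The Euclidean operator on the spin-network states -/

/-- The states of the free leg are separated by the generating variable `x`. -/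
theorem eq_zero_of_sum_pow_smul_eq_zero {N : ℕ} {w : ℕ → ℂ} (hw : ∀ c, w c ≠ 0) {v : ℕ → Cyl}
    (h : ∀ x : ℂ, ∑ c ∈ Finset.range N, (x ^ c / w c) • v c = 0) {c : ℕ} (hc : c < N) :
    v c = 0 := by
  ext g
  have h1 : ∑ c ∈ Finset.range N, C ((v c).1 g / w c) * X ^ c = (0 : ℂ[X]) := by
    refine Polynomial.funext fun x => ?_
    have h2 : (∑ c ∈ Finset.range N, (x ^ c / w c) • v c).1 g = 0 := by rw [h x]; rfl
    simp only [AddSubmonoidClass.coe_finsetSum, Submodule.coe_smul, Finset.sum_apply,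
      Pi.smul_apply, smul_eq_mul] at h2
    rw [eval_finsetSum, eval_zero, ← h2]
    refine Finset.sum_congr rfl fun c _ => ?_
    rw [eval_mul, eval_C, eval_pow, eval_X]
    ring
  have h2 := congrArg (fun p => coeff p c) h1
  simp only [finsetSum_coeff, coeff_C_mul_X_pow, coeff_zero] at h2
  rw [Finset.sum_ite_eq, if_pos (Finset.mem_range.2 hc)] at h2
  exact (div_eq_zero_iff.1 h2).resolve_right (hw c)

theorem threeJNorm_succ {n k : ℕ} (hk : k ≤ n) :
    threeJNorm n k = √((n - k + 1) * (n + k + 2) : ℝ) * threeJNorm (n + 1) k := by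
  have hnk : (0 : ℝ) ≤ n - k := sub_nonneg.2 (by exact_mod_cast hk)
  rw [threeJNorm, threeJNorm, ← Real.sqrt_mul (by positivity)]
  congr 1
  rw [show n + 1 + k + 1 = (n + k + 1) + 1 by ring, Nat.factorial_succ (n + k + 1),
    show n + 1 - k = (n - k) + 1 by omega, Nat.factorial_succ (n - k)]
  push_cast [Nat.cast_sub hk]
  have : (n : ℝ) - k + 1 ≠ 0 := by positivity
  field_simp
  ring

theorem sqrt_mul_ketNorm_succ {n k : ℕ} (hk : k ≤ n) :
    (√((n - k + 1) * (n + k + 2) : ℝ) : ℂ) * ketNorm (n + 1) k =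
      (n + 1 - k) * ketNorm n k := by
  rw [ketNorm, ketNorm, threeJNorm_succ hk, show n + 1 - k = (n - k) + 1 by omega,
    Nat.factorial_succ (n - k)]
  push_cast [Nat.cast_sub hk]
  ring

theorem sqrt_mul_ketNorm {n k : ℕ} (hk : k ≤ n) :
    (√((n - k + 1) * (n + k + 2) : ℝ) : ℂ) * ketNorm n k =
      (n + k + 2) * ketNorm (n + 1) k := by
  have hnk : (0 : ℝ) ≤ n - k := sub_nonneg.2 (by exact_mod_cast hk)
  have hs : (√((n - k + 1) * (n + k + 2) : ℝ) : ℂ) ^ 2 = (n - k + 1) * (n + k + 2) := by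
    exact_mod_cast Real.sq_sqrt (show (0 : ℝ) ≤ (n - k + 1) * (n + k + 2) by positivity)
  rw [ketNorm, ketNorm, threeJNorm_succ hk, show n + 1 - k = (n - k) + 1 by omega,
    Nat.factorial_succ (n - k)]
  push_cast [Nat.cast_sub hk] at hs ⊢
  linear_combination ((-1) ^ k * (threeJNorm (n + 1) k : ℂ) * (n - k).factorial) * hs

theorem HE_one_ketGV' (B : SU2Basis) {n k c : ℕ} (hn : n ≠ 0) (hk : k ≤ n) (hc : c ≤ 2 * k) :
    HE B 1 (ketGV' n k c) =
      ((√((n - k + 1) * (n + k + 2)) * (n + 3 + k * (k + 1)) / (2 * (n + 1)) : ℝ) : ℂ) •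
        ketGV' (n + 1) k c -
      ((√((n - k) * (n + k + 1)) * (n - 1 - k * (k + 1)) / (2 * (n + 1)) : ℝ) : ℂ) •
        ketGV' (n - 1) k c := by
  rw [← sub_eq_zero]
  refine eq_zero_of_sum_pow_smul_eq_zero (N := 2 * k + 1)
    (w := fun c => (monomialNorm (2 * k) c : ℂ)) (fun c => monomialNorm_ne_zero _ _)
    (v := fun c => HE B 1 (ketGV' n k c) -
      (((√((n - k + 1) * (n + k + 2)) * (n + 3 + k * (k + 1)) / (2 * (n + 1)) : ℝ) : ℂ) •
        ketGV' (n + 1) k c -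
      ((√((n - k) * (n + k + 1)) * (n - 1 - k * (k + 1)) / (2 * (n + 1)) : ℝ) : ℂ) •
        ketGV' (n - 1) k c)) (fun x => ?_) (Nat.lt_succ_of_le hc)
  have hne : (n : ℂ) + 1 ≠ 0 := by exact_mod_cast n.succ_ne_zero
  simp only [smul_sub, Finset.sum_sub_distrib, smul_comm (x ^ _ / _), ← Finset.smul_sum,
    sum_smul_ketGV']
  simp only [← map_smul, ← map_sum, sum_smul_ketGV']
  rw [map_smul, HE_one_weightState B (trace_nilpotentMatrix x) (det_nilpotentMatrix x) n k hn]
  have h1 : ((√((n - k + 1) * (n + k + 2)) * (n + 3 + k * (k + 1)) / (2 * (n + 1)) : ℝ) : ℂ) *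
      ketNorm (n + 1) k =
      ketNorm n k * ((n + 1 - k) * (n + 3 + k * (k + 1)) / (2 * (n + 1))) := by
    have := sqrt_mul_ketNorm_succ hk
    push_cast at this ⊢
    field_simp
    linear_combination (n + 3 + k * (k + 1) : ℂ) * this
  have h2 : (((√((n - k) * (n + k + 1)) * (n - 1 - k * (k + 1)) / (2 * (n + 1)) : ℝ) : ℂ) *
      ketNorm (n - 1) k) • weightState (nilpotentMatrix x) (n - 1) k =
      (ketNorm n k * ((n + 1 + k) * (n - 1 - k * (k + 1)) / (2 * (n + 1)))) •
        weightState (nilpotentMatrix x) (n - 1) k := by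
    obtain ⟨m, rfl⟩ := Nat.exists_eq_succ_of_ne_zero hn
    rw [Nat.succ_eq_add_one, Nat.add_sub_cancel]
    rcases Nat.lt_or_ge m k with hm | hm
    · rw [weightState_eq_zero _ hm, smul_zero, smul_zero]
    · have := sqrt_mul_ketNorm hm
      congr 1
      push_cast at this hne ⊢
      rw [show (m : ℝ) + 1 - k = m - k + 1 by ring, show (m : ℝ) + 1 + k + 1 = m + k + 2 by ring]
      field_simp
      linear_combination (m - k * (k + 1) : ℂ) * this
  rw [smul_smul, smul_smul, h1, h2, smul_sub, smul_smul, smul_smul, sub_self]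

theorem HE_one_ketGV (B : SU2Basis) {n k c : ℕ} (hn : n ≠ 0) (hk : k ≤ n) (hc : c ≤ 2 * k) :
    HE B 1 (ketGV n k c) =
      ((√((n - k + 1) * (n + k + 2)) * (n + 3 + k * (k + 1)) / (2 * √((n + 1) * (n + 2))) : ℝ) :
        ℂ) • ketGV (n + 1) k c -
      ((√((n - k) * (n + k + 1)) * (n - 1 - k * (k + 1)) / (2 * √(n * (n + 1))) : ℝ) : ℂ) •
        ketGV (n - 1) k c := by
  have hn0 : (0 : ℝ) < n := by exact_mod_cast Nat.pos_of_ne_zero hn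
  have hsq : √((n : ℝ) + 1) ^ 2 = n + 1 := Real.sq_sqrt (by positivity)
  have hn1 : (((n - 1 : ℕ) : ℝ) + 1) = n := by
    rw [Nat.cast_sub (Nat.one_le_iff_ne_zero.2 hn)]; simp
  rw [ketGV, ketGV, ketGV, map_smul, HE_one_ketGV' B hn hk hc, smul_sub]
  simp only [smul_smul, ← Complex.ofReal_mul]
  rw [hn1, Real.sqrt_mul (show (0 : ℝ) ≤ n + 1 by positivity), Real.sqrt_mul hn0.le]
  have p1 : 0 < √((n : ℝ) + 1) := Real.sqrt_pos.2 (by positivity)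
  have p2 : 0 < √((n : ℝ) + 2) := Real.sqrt_pos.2 (by positivity)
  have p3 : 0 < √(n : ℝ) := Real.sqrt_pos.2 hn0
  have e2 : √((↑(n + 1) : ℝ) + 1) = √((n : ℝ) + 2) := by
    congr 1; push_cast; ring
  have q1 : ∀ s : ℝ, √((n : ℝ) + 1) * (s / (2 * (n + 1))) =
      s / (2 * (√((n : ℝ) + 1) * √((n : ℝ) + 2))) * √((n : ℝ) + 2) := by
    intro s
    field_simp
    linear_combination s * hsq
  have q2 : ∀ s : ℝ, √((n : ℝ) + 1) * (s / (2 * (n + 1))) =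
      s / (2 * (√(n : ℝ) * √((n : ℝ) + 1))) * √(n : ℝ) := by
    intro s
    field_simp
    linear_combination s * hsq
  rw [e2, q1, q2]

theorem ketGV_zero_zero (n : ℕ) : ketGV n 0 0 = ket n := by
  have hi : ((√((n : ℝ) + 1) : ℝ) : ℂ) • intertwiner n 0 0 = 1 := by
    ext a b
    rw [Matrix.smul_apply, intertwiner_apply (Nat.zero_le n) (Nat.zero_le _), one_apply]
    simp only [zero_add, ← Fin.ext_iff, smul_eq_mul, eq_comm (a := b)]
    split_ifs with h
    · subst h
      have ha : a.1 ≤ n := Nat.lt_succ_iff.1 a.2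
      have hr : racahSum n 0 a a = n.choose a.1 := by
        simp only [racahSum, zero_add, Finset.sum_range_one, Nat.zero_le, add_zero, le_refl,
          and_self, if_true, Nat.choose_self, Nat.sub_zero, Nat.sub_self]
        rw [← two_mul, pow_mul]
        simp
      have hw := monomialNorm_sq n a
      have hc : ((n - a.1).factorial * a.1.factorial * n.choose a.1 : ℂ) = n.factorial := by
        rw [← Nat.choose_mul_factorial_mul_factorial ha]; push_cast; ring
      have ht : √((n : ℝ) + 1) * (threeJNorm n 0 * n.factorial) = 1 := by
        rw [threeJNorm, ← mul_assoc, ← Real.sqrt_mul (by positivity)]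
        have hf : (0 : ℝ) ≤ n.factorial := by positivity
        rw [← Real.sqrt_sq hf]
        rw [← Real.sqrt_mul (by positivity), Real.sqrt_eq_one]
        rw [Nat.add_zero, Nat.factorial_succ, Nat.sub_zero]
        push_cast [Nat.factorial_zero]
        have : (n.factorial : ℝ) ≠ 0 := by exact_mod_cast n.factorial_ne_zero
        field_simp
      have h0 : (monomialNorm (2 * 0) 0 : ℂ) = 1 := by simp [monomialNorm]
      have ht' : ((√((n : ℝ) + 1) : ℝ) : ℂ) * (threeJNorm n 0 * n.factorial) = 1 := by
        exact_mod_cast ht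
      rw [hr, h0]
      linear_combination ht' + ((√((n : ℝ) + 1) : ℝ) : ℂ) * threeJNorm n 0 *
        (hc + n.choose a.1 * hw)
    · simp
  ext g
  change ((√((n : ℝ) + 1) : ℝ) : ℂ) * (wignerD n g.1 * intertwiner n 0 0).trace =
    (wignerD n g.1 * 1).trace
  rw [← hi, Matrix.mul_smul, trace_smul, smul_eq_mul]

theorem HE_one_ket (B : SU2Basis) {n : ℕ} (hn : n ≠ 0) :
    HE B 1 (ket n) =
      (((n + 3) / 2 : ℝ) : ℂ) • ket (n + 1) - (((n - 1) / 2 : ℝ) : ℂ) • ket (n - 1) := by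
  have hn0 : (0 : ℝ) < n := by exact_mod_cast Nat.pos_of_ne_zero hn
  have h := HE_one_ketGV B hn (Nat.zero_le n) (le_refl (2 * 0))
  have p1 : √(((n : ℝ) + 1) * (n + 2)) ≠ 0 := (Real.sqrt_pos.2 (by positivity)).ne'
  have p2 : √((n : ℝ) * (n + 1)) ≠ 0 := (Real.sqrt_pos.2 (by positivity)).ne'
  simp only [ketGV_zero_zero, mul_zero, Nat.cast_zero, sub_zero, add_zero, zero_mul,
    zero_add] at h
  rw [h]
  congr 3
  · field_simp
  · field_simp

/-! ### The Lorentzian operator on `|j⟩` -/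

theorem ket_apply (n : ℕ) (g : SU2) :
    (ket n).1 g = (Chebyshev.S ℂ n).eval g.1.trace := by
  change (wignerD n g.1 * 1).trace = _
  rw [Matrix.mul_one, trace_wignerD_eq_eval_S n (mem_specialUnitaryGroup_iff.1 g.2).2]

section

variable (B : SU2Basis)

theorem Jbeg_ket (n : ℕ) (k : Fin 3) :
    Jbeg B k (ket n) =
      Complex.I • tracePoly (B.τ k) X (derivative (Chebyshev.S ℂ n)) := by
  have h : ket n = tracePoly 0 1 (Chebyshev.S ℂ n) := by
    ext g
    rw [ket_apply, tracePoly_apply, eval_one, one_mul]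
  ext g
  rw [h, Jbeg_tracePoly_apply]
  change _ = Complex.I * (tracePoly _ _ _).1 g
  simp [tracePoly_apply]

theorem Jend_ket (n : ℕ) (k : Fin 3) :
    Jend B k (ket n) =
      -Complex.I • tracePoly (B.τ k) X (derivative (Chebyshev.S ℂ n)) := by
  have h : ket n = tracePoly 0 1 (Chebyshev.S ℂ n) := by
    ext g
    rw [ket_apply, tracePoly_apply, eval_one, one_mul]
  ext g
  rw [h, Jend_tracePoly_apply]
  change _ = -Complex.I * (tracePoly _ _ _).1 g
  simp [tracePoly_apply, trace_mul_comm (B.τ k)]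

theorem Jbeg_Jbeg_tracePoly_apply (E : Matrix (Fin 2) (Fin 2) ℂ) (q p : ℂ[X]) (g : SU2)
    (j k : Fin 3) :
    (Jbeg B j (Jbeg B k (tracePoly E q p))).1 g =
      -((g.1 * (B.τ j * B.τ k) * E).trace * (tracePoly E q.derivative p).1 g +
        (g.1 * (B.τ j * B.τ k)).trace * (tracePoly E q p.derivative).1 g +
      (g.1 * B.τ k * E).trace * ((g.1 * B.τ j * E).trace *
          (tracePoly E q.derivative.derivative p).1 g +
        (g.1 * B.τ j).trace * (tracePoly E q.derivative p.derivative).1 g) +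
      (g.1 * B.τ k).trace * ((g.1 * B.τ j * E).trace *
          (tracePoly E q.derivative p.derivative).1 g +
        (g.1 * B.τ j).trace * (tracePoly E q p.derivative.derivative).1 g)) := by
  have hd := (((B.hasDerivAt_trace_right j g (B.τ k * E)).mul
    (B.hasDerivAt_cyl_right j (tracePoly E q.derivative p) g)).add
    ((B.hasDerivAt_trace_right j g (B.τ k)).mul
    (B.hasDerivAt_cyl_right j (tracePoly E q p.derivative) g))).const_mul Complex.I
  simp only [B.exp_zero, mul_one] at hd
  rw [B.Jbeg_apply_of_hasDerivAt (d := _) j _ g (hd.congr_of_eventuallyEq (.of_forall fun t => by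
    beta_reduce
    rw [Jbeg_tracePoly_apply, Matrix.mul_assoc (g * B.exp j t).1]; rfl))]
  simp only [Jbeg_tracePoly_apply, ← Matrix.mul_assoc]
  generalize (tracePoly E q.derivative p).1 g = f1
  generalize (tracePoly E q p.derivative).1 g = f2
  generalize (tracePoly E q.derivative.derivative p).1 g = f3
  generalize (tracePoly E q.derivative p.derivative).1 g = f4
  generalize (tracePoly E q p.derivative.derivative).1 g = f5
  ring_nf
  simp only [Complex.I_sq, show Complex.I ^ 4 = 1 from Complex.I_pow_four]
  ring

theorem sum_eps_mul_of_symm (i : Fin 3) {s : Fin 3 → Fin 3 → ℂ} (h : ∀ j k, s j k = s k j) :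
    ∑ j, ∑ k, eps i j k * s j k = 0 := by
  have h1 := h 1 0
  have h2 := h 2 0
  have h3 := h 2 1
  simp only [Fin.sum_univ_three, eps, h1, h2, h3]
  ring

/-- The commutation relations of the beginning segment, contracted with `ε`. -/
theorem sum_eps_Jbeg_Jbeg_tracePoly (E : Matrix (Fin 2) (Fin 2) ℂ) (q p : ℂ[X]) (i : Fin 3) :
    ∑ j, ∑ k, eps i j k • Jbeg B j (Jbeg B k (tracePoly E q p)) =
      Complex.I • Jbeg B i (tracePoly E q p) := by
  ext g
  have h1 := congrArg (fun M => (g.1 * M * E).trace) (B.sum_eps_mul i)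
  have h2 := congrArg (fun M => (g.1 * M).trace) (B.sum_eps_mul i)
  simp only [Finset.mul_sum, Finset.sum_mul, trace_sum, Matrix.mul_smul, Matrix.smul_mul,
    trace_smul, smul_eq_mul] at h1 h2
  have h3 := sum_eps_mul_of_symm i (s := fun j k =>
    (g.1 * B.τ k * E).trace * ((g.1 * B.τ j * E).trace *
          (tracePoly E q.derivative.derivative p).1 g +
        (g.1 * B.τ j).trace * (tracePoly E q.derivative p.derivative).1 g) +
      (g.1 * B.τ k).trace * ((g.1 * B.τ j * E).trace *
          (tracePoly E q.derivative p.derivative).1 g +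
        (g.1 * B.τ j).trace * (tracePoly E q p.derivative.derivative).1 g)) fun j k => by ring
  have hl : (∑ j, ∑ k, eps i j k • Jbeg B j (Jbeg B k (tracePoly E q p))).1 g =
      ∑ j, ∑ k, eps i j k * (Jbeg B j (Jbeg B k (tracePoly E q p))).1 g := by
    simp [Finset.sum_apply]
  rw [hl]
  change _ = Complex.I * (Jbeg B i (tracePoly E q p)).1 g
  rw [Jbeg_tracePoly_apply, ← mul_assoc, Complex.I_mul_I, ← h1, ← h2]
  rw [← sub_eq_zero, ← neg_eq_zero, ← h3]
  simp only [Jbeg_Jbeg_tracePoly_apply, Finset.sum_mul, Finset.mul_sum,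
    ← Finset.sum_add_distrib, ← Finset.sum_sub_distrib, ← Finset.sum_neg_distrib]
  refine Finset.sum_congr rfl fun j _ => Finset.sum_congr rfl fun k _ => ?_
  ring

/-- The commutation relations of the ending segment, contracted with `ε`, on `|j⟩`. -/
theorem sum_eps_Jend_Jend_ket (n : ℕ) (i : Fin 3) :
    ∑ j, ∑ k, eps i j k • Jend B j (Jend B k (ket n)) =
      tracePoly (B.τ i) X (derivative (Chebyshev.S ℂ n)) := by
  ext g
  have h2 := congrArg (fun M => (g.1 * M).trace) (B.sum_eps_mul i)
  simp only [Finset.mul_sum, trace_sum, Matrix.mul_smul, trace_smul, smul_eq_mul] at h2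
  have h3 := sum_eps_mul_of_symm i (s := fun j k => (g.1 * B.τ j).trace * (g.1 * B.τ k).trace *
    eval g.1.trace (derivative (derivative (Chebyshev.S ℂ n)))) fun j k => by ring
  have hl : (∑ j, ∑ k, eps i j k • Jend B j (Jend B k (ket n))).1 g =
      ∑ j, ∑ k, eps i j k * (Jend B j (Jend B k (ket n))).1 g := by
    simp [Finset.sum_apply]
  have hj : ∀ j k, (Jend B j (Jend B k (ket n))).1 g =
      -((g.1 * (B.τ k * B.τ j)).trace * eval g.1.trace (derivative (Chebyshev.S ℂ n)) +
        (g.1 * B.τ j).trace * (g.1 * B.τ k).trace *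
          eval g.1.trace (derivative (derivative (Chebyshev.S ℂ n)))) := by
    intro j k
    rw [Jend_ket, map_smul]
    change -Complex.I * (Jend B j (tracePoly _ _ _)).1 g = _
    rw [Jend_tracePoly_apply, Matrix.mul_assoc (B.τ j), trace_mul_comm (B.τ j),
      trace_mul_comm (B.τ j), Matrix.mul_assoc g.1]
    simp only [tracePoly_apply, derivative_X, eval_one, one_mul, eval_X]
    linear_combination ((g.1 * (B.τ k * B.τ j)).trace *
      eval g.1.trace (derivative (Chebyshev.S ℂ n)) + (g.1 * B.τ j).trace * (g.1 * B.τ k).trace *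
          eval g.1.trace (derivative (derivative (Chebyshev.S ℂ n)))) * Complex.I_sq
  have h4 : (g.1 * B.τ i).trace = ∑ j, ∑ k, -(eps i j k * (g.1 * (B.τ k * B.τ j)).trace) := by
    rw [← h2, Finset.sum_comm]
    refine Finset.sum_congr rfl fun j _ => Finset.sum_congr rfl fun k _ => ?_
    rw [show eps i k j = -eps i j k by simp only [eps]; ring]
    ring
  rw [hl, tracePoly_apply, eval_X, h4, ← sub_eq_zero, ← neg_eq_zero, ← h3]
  simp only [hj, Finset.sum_mul, ← Finset.sum_sub_distrib, ← Finset.sum_neg_distrib]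
  refine Finset.sum_congr rfl fun j _ => Finset.sum_congr rfl fun k _ => ?_
  ring

/-- The quadratic Casimir operator on `|j⟩`, by the Chebyshev differential equation. -/
theorem sum_Jbeg_tracePoly (n : ℕ) :
    ∑ k, Jbeg B k (tracePoly (B.τ k) X (derivative (Chebyshev.S ℂ n))) =
      (-Complex.I * (n * (n + 2) / 4)) • ket n := by
  ext g
  have hl : (∑ k, Jbeg B k (tracePoly (B.τ k) X (derivative (Chebyshev.S ℂ n)))).1 g =
      ∑ k, (Jbeg B k (tracePoly (B.τ k) X (derivative (Chebyshev.S ℂ n)))).1 g := by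
    simp [Finset.sum_apply]
  have h1 : ∑ k, (g.1 * B.τ k * B.τ k).trace = -3 / 4 * g.1.trace := by
    have h := B.sum_mul_mul g.1
    have h' := congrArg trace h
    rw [trace_sum, trace_sub, trace_smul, trace_smul, trace_one, smul_eq_mul, smul_eq_mul,
      Fintype.card_fin] at h'
    simp only [Matrix.mul_assoc, trace_mul_comm (B.τ _)] at h' ⊢
    rw [h']
    push_cast
    ring
  have h2 := B.sum_trace_mul_trace g.1 g.1
  have h3 : (g.1 * g.1).trace = g.1.trace ^ 2 - 2 := by
    rw [SU2_mul_self, trace_sub, trace_smul, trace_one, smul_eq_mul, Fintype.card_fin]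
    push_cast
    ring
  have h4 := congrArg (eval g.1.trace)
    (Chebyshev.X_sq_sub_four_mul_derivative_derivative_S n)
  simp only [eval_add, eval_sub, eval_mul, eval_pow, eval_X, eval_ofNat, eval_natCast] at h4
  have h5 : ∀ k, (Jbeg B k (tracePoly (B.τ k) X (derivative (Chebyshev.S ℂ n)))).1 g =
      Complex.I * ((g.1 * B.τ k * B.τ k).trace *
        eval g.1.trace (derivative (Chebyshev.S ℂ n)) + (g.1 * B.τ k).trace *
        (g.1 * B.τ k).trace * eval g.1.trace (derivative (derivative (Chebyshev.S ℂ n)))) := by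
    intro k
    rw [Jbeg_tracePoly_apply]
    simp only [tracePoly_apply, derivative_X, eval_one, eval_X]
    ring
  rw [hl]
  change _ = -Complex.I * (n * (n + 2) / 4) * (ket n).1 g
  simp only [h5]
  rw [← Finset.mul_sum, Finset.sum_add_distrib, ← Finset.sum_mul, ← Finset.sum_mul, h1, h2, h3,
    ket_apply]
  linear_combination (-Complex.I / 4) * h4

theorem sum_Jend_tracePoly (n : ℕ) :
    ∑ k, Jend B k (tracePoly (B.τ k) X (derivative (Chebyshev.S ℂ n))) =
      (Complex.I * (n * (n + 2) / 4)) • ket n := by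
  have h : ∀ k, Jend B k (tracePoly (B.τ k) X (derivative (Chebyshev.S ℂ n))) =
      -Jbeg B k (tracePoly (B.τ k) X (derivative (Chebyshev.S ℂ n))) := by
    intro k
    ext g
    change _ = -(Jbeg B k (tracePoly _ _ _)).1 g
    rw [Jbeg_tracePoly_apply, Jend_tracePoly_apply, Matrix.mul_assoc (B.τ k),
      trace_mul_comm (B.τ k), trace_mul_comm (B.τ k)]
    ring
  simp only [h, Finset.sum_neg_distrib, sum_Jbeg_tracePoly]
  ext g
  change -(-Complex.I * (n * (n + 2) / 4) * (ket n).1 g) =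
    Complex.I * (n * (n + 2) / 4) * (ket n).1 g
  ring

theorem dotOp_ket (n : ℕ) : dotOp B (ket n) = (-(n * (n + 2) / 4) : ℂ) • ket n := by
  simp only [dotOp, LinearMap.sum_apply, Module.End.mul_apply, Jend_ket, map_smul]
  rw [← Finset.smul_sum, sum_Jbeg_tracePoly, smul_smul]
  congr 1
  linear_combination (n * (n + 2) / 4 : ℂ) * Complex.I_sq

theorem begSq_ket (n : ℕ) : begSq B (ket n) = (n * (n + 2) / 4 : ℂ) • ket n := by
  simp only [begSq, LinearMap.sum_apply, Module.End.mul_apply, Jbeg_ket, map_smul]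
  rw [← Finset.smul_sum, sum_Jbeg_tracePoly, smul_smul]
  congr 1
  linear_combination (-(n * (n + 2) / 4) : ℂ) * Complex.I_sq

theorem endSq_ket (n : ℕ) : endSq B (ket n) = (n * (n + 2) / 4 : ℂ) • ket n := by
  simp only [endSq, LinearMap.sum_apply, Module.End.mul_apply, Jend_ket, map_smul]
  rw [← Finset.smul_sum, sum_Jend_tracePoly, smul_smul]
  congr 1
  linear_combination (-(n * (n + 2) / 4) : ℂ) * Complex.I_sq

theorem crossOp_ket (n : ℕ) : crossOp B (ket n) = (n * (n + 2) / 4 : ℂ) • ket n := by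
  simp only [crossOp, LinearMap.sum_apply, Module.End.mul_apply, LinearMap.smul_apply,
    sum_eps_Jend_Jend_ket, sum_eps_Jbeg_Jbeg_tracePoly]
  rw [← Finset.smul_sum, sum_Jbeg_tracePoly, smul_smul]
  congr 1
  linear_combination (-(n * (n + 2) / 4) : ℂ) * Complex.I_sq

end

/-- A joint eigenvector with eigenvalues in `S` lies in the domain of `Φ(T)` and is an eigenvector
of it. -/
theorem jointCalc_apply_of_eigen {ι E : Type*} [AddCommGroup E] [Module ℂ E]
    (T : ι → Module.End ℂ E) (S : Set (ι → ℝ)) (Φ : (ι → ℝ) → ℝ) {x : ι → ℝ} (hx : x ∈ S) {f : E}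
    (hf : ∀ i, T i f = (x i : ℂ) • f) :
    ∃ h : f ∈ (jointCalc T S Φ).domain, jointCalc T S Φ ⟨f, h⟩ = (Φ x : ℂ) • f := by
  have hm : (f, (Φ x : ℂ) • f) ∈ (jointCalc T S Φ).graph := by
    rw [jointCalc, Submodule.toLinearPMap_graph_eq _ (jointGraph_functional T S Φ)]
    exact Submodule.subset_span ⟨x, hx, hf, rfl⟩
  obtain ⟨⟨y, hy⟩, rfl, h⟩ := (LinearPMap.mem_graph_iff _).1 hm
  exact ⟨hy, h⟩

theorem HL_ket (B : SU2Basis) (𝔄 : ℝ) (n : ℕ) :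
    ∃ h : ket n ∈ (HL B 𝔄).domain, HL B 𝔄 ⟨ket n, h⟩ =
      ((2 * Real.pi / 𝔄 * √(n / 2 * (n / 2 + 1)) : ℝ) : ℂ) • ket n := by
  set c : ℝ := n / 2 * (n / 2 + 1) with hc
  have hc0 : 0 ≤ c := by positivity
  have hcC : (n * (n + 2) / 4 : ℂ) = (c : ℂ) := by rw [hc]; push_cast; ring
  obtain ⟨h, hv⟩ := jointCalc_apply_of_eigen ![crossOp B, dotOp B, begSq B, endSq B]
    {x | 0 ≤ x 0 ∧ 0 ≤ x 2 ∧ 0 ≤ x 3} (fun x =>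
      √(x 0) * (2 * Real.pi / 𝔄 - Real.pi + Real.arccos (x 1 / (√(x 2) * √(x 3)))))
    (x := ![c, -c, c, c]) ⟨hc0, hc0, hc0⟩ (f := ket n) (by
      intro i
      fin_cases i
      · exact (crossOp_ket B n).trans (by rw [hcC]; rfl)
      · exact (dotOp_ket B n).trans (by rw [hcC, ← Complex.ofReal_neg]; rfl)
      · exact (begSq_ket B n).trans (by rw [hcC]; rfl)
      · exact (endSq_ket B n).trans (by rw [hcC]; rfl))
  refine ⟨h, hv.trans ?_⟩
  congr 2
  change √c * (2 * Real.pi / 𝔄 - Real.pi + Real.arccos (-c / (√c * √c))) = _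
  rw [Real.mul_self_sqrt hc0]
  rcases hc0.eq_or_lt with h0 | h0
  · rw [← h0]; simp
  -- the quotient is `-1`, and `arccos (-1) = π`
  · rw [neg_div, div_self h0.ne', Real.arccos_neg_one]
    ring

end

theorem mainTheorem4 (B : SU2Basis) :
    -- the Euclidean operator with `l = 1/2` on `|j⟩`, `j ≠ 0`
    (∀ (n : ℕ) (j : ℝ), j = n / 2 → j ≠ 0 →
      HE B 1 (ket n) =
        ((j + 3 / 2 : ℝ) : ℂ) • ket (n + 1) - ((j - 1 / 2 : ℝ) : ℂ) • ket (n - 1)) ∧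
    -- the Lorentzian operator is diagonal
    (∀ 𝔄 : ℝ, 𝔄 ≠ 0 → ∀ (n : ℕ) (j : ℝ), j = n / 2 →
      ∃ h : ket n ∈ (HL B 𝔄).domain,
        HL B 𝔄 ⟨ket n, h⟩ = ((2 * Real.pi / 𝔄 * √(j * (j + 1)) : ℝ) : ℂ) • ket n) ∧
    (∀ (n : ℕ) (j : ℝ), j = n / 2 →
      ∃ h : ket n ∈ (HL B (2 * Real.pi)).domain,
        HL B (2 * Real.pi) ⟨ket n, h⟩ = ((√(j * (j + 1)) : ℝ) : ℂ) • ket n) ∧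
    -- `|j,0⟩ = |j⟩`
    (∀ n : ℕ, ketGV n 0 0 = ket n) ∧
    -- the Euclidean operator on the gauge-variant states `||j,k⟩` and `|j,k⟩`, `j ≠ 0`,
    -- `k ∈ {0, 1, …, 2j}`, for every component `m = k - c` of the free leg
    (∀ (n k c : ℕ) (j : ℝ), j = n / 2 → j ≠ 0 → k ≤ n → c ≤ 2 * k →
      HE B 1 (ketGV' n k c) =
        ((√((2 * j - k + 1) * (2 * j + k + 2)) * (2 * j + 3 + k * (k + 1)) /
            (2 * (2 * j + 1)) : ℝ) : ℂ) • ketGV' (n + 1) k c -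
        ((√((2 * j - k) * (2 * j + k + 1)) * (2 * j - 1 - k * (k + 1)) /
            (2 * (2 * j + 1)) : ℝ) : ℂ) • ketGV' (n - 1) k c) ∧
    (∀ (n k c : ℕ) (j : ℝ), j = n / 2 → j ≠ 0 → k ≤ n → c ≤ 2 * k →
      HE B 1 (ketGV n k c) =
        ((√((2 * j - k + 1) * (2 * j + k + 2)) * (2 * j + 3 + k * (k + 1)) /
            (2 * √((2 * j + 1) * (2 * j + 2))) : ℝ) : ℂ) • ketGV (n + 1) k c -
        ((√((2 * j - k) * (2 * j + k + 1)) * (2 * j - 1 - k * (k + 1)) /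
            (2 * √(2 * j * (2 * j + 1))) : ℝ) : ℂ) • ketGV (n - 1) k c) := by
  have hn : ∀ {n : ℕ} {j : ℝ}, j = n / 2 → j ≠ 0 → n ≠ 0 := by
    rintro n j rfl hj rfl
    exact hj (by simp)
  refine ⟨fun n j hj hj0 => ?_, fun 𝔄 _ n j hj => ?_, fun n j hj => ?_, ketGV_zero_zero,
    fun n k c j hj hj0 hk hc => ?_, fun n k c j hj hj0 hk hc => ?_⟩
  · rw [HE_one_ket B (hn hj hj0), hj]
    congr 3 <;> ring
  · subst hj
    exact HL_ket B 𝔄 n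
  · subst hj
    obtain ⟨h, hv⟩ := HL_ket B (2 * Real.pi) n
    refine ⟨h, hv.trans ?_⟩
    rw [div_self (by positivity), one_mul]
  · rw [HE_one_ketGV' B (hn hj hj0) hk hc, show (n : ℝ) = 2 * j by rw [hj]; ring]
  · rw [HE_one_ketGV B (hn hj hj0) hk hc, show (n : ℝ) = 2 * j by rw [hj]; ring]
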